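/- **Setting.** Let $\mathscr X$ (inputs) and $\mathscr Y$ (outputs) be measurable spaces, $p\ge 1$, and let $\mathscr D_1,\dots,\mathscr D_p$ be probability distributions on $\mathscr X\times\mathscr Y$ with a common conditional distribution $\mathscr D(\cdot\mid x)$ of $y$ given $x$, i.e. $\mathscr D_k(x,y)=\mathscr D_k(x)\,\mathscr D(y\mid x)$. Let $\Delta$ be the simplex in $\mathbb R^p$, $\mathcal D=\{\sum_{k}\lambda_k\mathscr D_k:\lambda\in\Delta\}$, and $\mathscr D(x)=\frac1p\sum_{k}\mathscr D_k(x)$. For $1<\alpha<\infty$ put $$\mathsf d_\alpha(\mathscr P\,\|\,\mathscr Q)=\Big[\int\Big(\frac{d\mathscr P}{d\mathscr Q}\Big)^{\alpha}d\mathscr Q\Big]^{\frac1{\alpha-1}}\in[0,\infty]$$ if $\mathscr P\ll\mathscr Q$ (on a countable space this is $\big[\sum \mathscr P^\alpha/\mathscr Q^{\alpha-1}\big]^{1/(\alpha-1)}$) and $\mathsf d_\alpha(\mathscr P\|\mathscr Q)=\infty$ otherwise; $\mathsf d_\infty(\mathscr P\|\mathscr Q)$ is the $\mathscr Q$-essential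 supremum of $d\mathscr P/d\mathscr Q$ if $\mathscr P\ll\mathscr Q$ and $\infty$ otherwise. Let $\mathsf d_\alpha(\mathscr P\|\mathcal D)=\inf_{\mathscr Q\in\mathcal D}\mathsf d_\alpha(\mathscr P\|\mathscr Q)$. Let $\widehat{\mathscr Q}(k\mid x)\in(0,1]$ be measurable in $x$, for $k\in[p]$ (estimates of the conditional probability that $x$ comes from domain $k$). Put $$\widehat{\mathscr Q}(k)=\int\widehat{\mathscr Q}(k\mid x)\,d\mathscr D(x),\qquad \widehat{\mathscr D}_k(x)=\frac{\widehat{\mathscr Q}(k\mid x)\,\mathscr D(x)}{\widehat{\mathscr Q}(k)},\qquad \widehat{\mathscr D}_k(x,y)=\widehat{\mathscr D}_k(x)\,\mathscr D(y\mid x).$$ Consider measurable predictors $h_1,\dots,h_p$ and a loss $\ell$ in one of two models. (R) Regression: $h_k\colon\mathscr X\to\mathbb R$; $\ell\colon\mathbb R\times\mathscr Y\to[0,\infty)$ is measurable, and convex and continuous in its first argument; $\mathcal L(\mathscr P,h)=\mathbb E_{(x,y)\sim\mathscr P}[\ell(h(x),y)]$; $\widehat g_z(x)=\sum_k\frac{z_k\widehat{\mathscr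 Q}(k\mid x)}{\sum_j z_j\widehat{\mathscr Q}(j\mid x)}h_k(x)$. (P) Probability: $h_k\colon\mathscr X\times\mathscr Y\to[0,1]$; $\ell\colon[0,1]\to[0,\infty]$ is convex and continuous; $\mathcal L(\mathscr P,h)=\mathbb E_{(x,y)\sim\mathscr P}[\ell(h(x,y))]$; $\widehat g_z(x,y)=\sum_k\frac{z_k\widehat{\mathscr Q}(k\mid x)}{\sum_j z_j\widehat{\mathscr Q}(j\mid x)}h_k(x,y)$. Let $\epsilon>0$ and $0\le M<\infty$ be such that $\mathcal L(\mathscr D_k,h_k)\le\epsilon$ for all $k$, and $\ell(h_k(x),y)\le M$ (respectively $\ell(h_k(x,y))\le M$) for all $k,x,y$. **Theorem.** In either model, for any $\delta>0$ there exists $z\in\Delta$ such that, for every $\alpha\in(1,\infty]$ and every probability distribution $\mathscr D_T$ on $\mathscr X\times\mathscr Y$, $$\mathcal L(\mathscr D_T,\widehat g_z)\le\big[(\widehat\epsilon+\delta)\,\widehat{\mathsf d}'\big]^{\frac{\alpha-1}{\alpha}}\big[\mathsf d_{2\alpha}(\mathscr D_T\,\|\,\mathcal D)\big]^{\frac{2\alpha-1}{2\alpha}}M^{\frac1\alpha},$$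 where $$\widehat\epsilon=(\epsilon\,\widehat{\mathsf d})^{\frac{\alpha-1}{\alpha}}M^{\frac1\alpha},\qquad \widehat{\mathsf d}=\max_{k\in[p]}\mathsf d_\alpha(\widehat{\mathscr D}_k\,\|\,\mathscr D_k),\qquad \widehat{\mathsf d}'=\max_{k\in[p]}\mathsf d_{2\alpha-1}(\mathscr D_k\,\|\,\widehat{\mathscr D}_k).$$ The right-hand side is computed in $[0,\infty]$ with $0\cdot\infty=0$ and $0^0=\infty^0=1$; for $\alpha=\infty$ the exponents $\frac{\alpha-1}{\alpha},\frac{2\alpha-1}{2\alpha},\frac1\alpha$ are read as $1,1,0$. -/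

import Mathlib

open MeasureTheory ProbabilityTheory
open scoped ENNReal NNReal

namespace MSA

noncomputable section

variable {X Y Ω : Type*} [MeasurableSpace X] [MeasurableSpace Y] [MeasurableSpace Ω]

/-- The exponential `d_α(P ‖ Q)` of the Rényi divergence of order `α ∈ (1, ∞]`, with values in
`[0, ∞]`: `(∫ (dP/dQ)^α dQ)^(1/(α-1))` for finite `α`, the essential supremum of `dP/dQ` for
`α = ∞`, and `∞` if `P` is not absolutely continuous with respect to `Q`. On countable spaces it is
`(∑ P^α / Q^(α-1))^(1/(α-1))`, see `expRenyi_eq_tsum`. -/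
def expRenyi (α : ℝ≥0∞) (P Q : Measure Ω) : ℝ≥0∞ :=
  open Classical in
  if P ≪ Q then
    if α = ∞ then essSup (P.rnDeriv Q) Q
    else (∫⁻ a, (P.rnDeriv Q a) ^ α.toReal ∂Q) ^ (1 / (α.toReal - 1))
  else ∞

/-- The mixture `D_w = ∑ k, w_k D_k`. -/
def mixture {p : ℕ} (D : Fin p → Measure Ω) (w : Fin p → ℝ) : Measure Ω :=
  ∑ k, ENNReal.ofReal (w k) • D k

/-- `d_α(P ‖ 𝒟)`, where `𝒟` is the family of all mixtures of the `D k`. -/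
def expRenyiFamily {p : ℕ} (α : ℝ≥0∞) (P : Measure Ω) (D : Fin p → Measure Ω) : ℝ≥0∞ :=
  ⨅ w ∈ stdSimplex ℝ (Fin p), expRenyi α P (mixture D w)

/-- The average `D(x) = (1/p) ∑ k, D_k(x)` of the marginals on the input space. -/
def avgMarginal {p : ℕ} (D : Fin p → Measure (X × Y)) : Measure X :=
  (p : ℝ≥0∞)⁻¹ • ∑ k, (D k).fst

/-- `Q̂(k) = ∑ x, Q̂(k | x) D(x)`. Here and below `Qhat k x` stands for `Q̂(k | x)`. -/
def domainWeight {p : ℕ} (D : Fin p → Measure (X × Y)) (Qhat : Fin p → X → ℝ) (k : Fin p) :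
    ℝ≥0∞ :=
  ∫⁻ x, ENNReal.ofReal (Qhat k x) ∂(avgMarginal D)

/-- The induced estimate `D̂_k(x) = Q̂(k | x) D(x) / Q̂(k)` of the marginal of `D_k`. -/
def estMarginal {p : ℕ} (D : Fin p → Measure (X × Y)) (Qhat : Fin p → X → ℝ) (k : Fin p) :
    Measure X :=
  (avgMarginal D).withDensity fun x => ENNReal.ofReal (Qhat k x) / domainWeight D Qhat k

/-- The joint distribution `D̂_k(x, y) = D̂_k(x) D(y | x)`; the kernel `κ` is `D(· | x)`. -/
def estJoint {p : ℕ} (D : Fin p → Measure (X × Y)) (κ : Kernel X Y) (Qhat : Fin p → X → ℝ)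
    (k : Fin p) : Measure (X × Y) :=
  estMarginal D Qhat k ⊗ₘ κ

/-- `d̂ = max_k d_α(D̂_k ‖ D_k)`. -/
def dHat {p : ℕ} (α : ℝ≥0∞) (D : Fin p → Measure (X × Y)) (κ : Kernel X Y)
    (Qhat : Fin p → X → ℝ) : ℝ≥0∞ :=
  ⨆ k, expRenyi α (estJoint D κ Qhat k) (D k)

/-- `d̂' = max_k d_{2α-1}(D_k ‖ D̂_k)`. -/
def dHat' {p : ℕ} (α : ℝ≥0∞) (D : Fin p → Measure (X × Y)) (κ : Kernel X Y)
    (Qhat : Fin p → X → ℝ) : ℝ≥0∞ :=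
  ⨆ k, expRenyi (2 * α - 1) (D k) (estJoint D κ Qhat k)

/-- `ε̂ = (ε d̂)^((α-1)/α) M^(1/α)`. The exponent `(α-1)/α` is written `1 - 1/α`, which is right for
`α = ∞` too. -/
def epsHat {p : ℕ} (α : ℝ≥0∞) (ε M : ℝ≥0) (D : Fin p → Measure (X × Y)) (κ : Kernel X Y)
    (Qhat : Fin p → X → ℝ) : ℝ≥0∞ :=
  (ε * dHat α D κ Qhat) ^ (1 - 1 / α).toReal * (M : ℝ≥0∞) ^ (1 / α).toReal

/-- Weights `z_k Q̂(k | x) / ∑ j, z_j Q̂(j | x)` of the discriminative combination. -/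
def combWeight {p : ℕ} (Qhat : Fin p → X → ℝ) (z : Fin p → ℝ) (k : Fin p) (x : X) : ℝ :=
  z k * Qhat k x / ∑ j, z j * Qhat j x

/-- The discriminative combination `ĝ_z(x)` in the regression model. -/
def gHatReg {p : ℕ} (Qhat : Fin p → X → ℝ) (h : Fin p → X → ℝ) (z : Fin p → ℝ) (x : X) : ℝ :=
  ∑ k, combWeight Qhat z k x * h k x

/-- The discriminative combination `ĝ_z(x, y)` in the probability model. -/
def gHatProb {p : ℕ} (Qhat : Fin p → X → ℝ) (h : Fin p → X → Y → ℝ) (z : Fin p → ℝ)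
    (x : X) (y : Y) : ℝ :=
  ∑ k, combWeight Qhat z k x * h k x y

/-- Expected loss `𝓛(D, h) = E_{(x,y) ∼ D} ℓ(h(x), y)` in the regression model. -/
def lossReg (l : ℝ → Y → ℝ≥0) (D : Measure (X × Y)) (h : X → ℝ) : ℝ≥0∞ :=
  ∫⁻ q, (l (h q.1) q.2 : ℝ≥0∞) ∂D

/-- Expected loss `𝓛(D, h) = E_{(x,y) ∼ D} ℓ(h(x, y))` in the probability model. -/
def lossProb (l : ℝ → ℝ≥0∞) (D : Measure (X × Y)) (h : X → Y → ℝ) : ℝ≥0∞ :=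
  ∫⁻ q, l (h q.1 q.2) ∂D

/-- The right-hand side
`[(ε̂ + δ) d̂']^((α-1)/α) [d_{2α}(T ‖ 𝒟)]^((2α-1)/(2α)) M^(1/α)`, with the exponents
written as `1 - 1/α`, `1 - 1/(2α)` and `1/α`. -/
def guaranteeBound {p : ℕ} (α : ℝ≥0∞) (ε δ M : ℝ≥0) (D : Fin p → Measure (X × Y)) (κ : Kernel X Y)
    (Qhat : Fin p → X → ℝ) (T : Measure (X × Y)) : ℝ≥0∞ :=
  ((epsHat α ε M D κ Qhat + δ) * dHat' α D κ Qhat) ^ (1 - 1 / α).toReal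
    * (expRenyiFamily (2 * α) T D) ^ (1 - 1 / (2 * α)).toReal
    * (M : ℝ≥0∞) ^ (1 / α).toReal

/-- On countable spaces `d_α` is given by the usual sum. -/
theorem expRenyi_eq_tsum [Countable Ω] [MeasurableSingletonClass Ω] {α : ℝ} (hα : 1 < α)
    (P Q : Measure Ω) [IsProbabilityMeasure P] [IsProbabilityMeasure Q] :
    expRenyi (ENNReal.ofReal α) P Q = (∑' a, P {a} ^ α / Q {a} ^ (α - 1)) ^ (1 / (α - 1)) := by
  have hto : (ENNReal.ofReal α).toReal = α := ENNReal.toReal_ofReal (zero_lt_one.trans hα).le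
  simp only [expRenyi, ENNReal.ofReal_ne_top, if_false, hto]
  split_ifs with hPQ
  · rw [lintegral_countable']
    congr 2
    funext a
    have h1 : P {a} = P.rnDeriv Q a * Q {a} := by
      conv_lhs => rw [← Measure.withDensity_rnDeriv_eq P Q hPQ]
      rw [withDensity_apply _ (measurableSet_singleton a), lintegral_singleton]
    rcases eq_or_ne (Q {a}) 0 with h0 | h0
    · rw [h1, h0]
      simp [ENNReal.zero_rpow_of_pos (zero_lt_one.trans hα)]
    · have ht : Q {a} ≠ ∞ := measure_ne_top _ _
      rw [h1, ENNReal.mul_rpow_of_nonneg _ _ (zero_lt_one.trans hα).le, mul_div_assoc]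
      congr 1
      rw [← ENNReal.rpow_sub _ _ h0 ht]
      simp
  · have hex : ∃ a, Q {a} = 0 ∧ P {a} ≠ 0 := by
      by_contra! hcon
      refine hPQ fun s hs => ?_
      rw [← Set.biUnion_of_singleton s]
      refine (measure_biUnion_null_iff s.to_countable).2 fun a ha => hcon a ?_
      exact measure_mono_null (Set.singleton_subset_iff.2 ha) hs
    obtain ⟨a, hQ, hP⟩ := hex
    have hα' : 0 < α - 1 := by linarith
    have : ∑' a, P {a} ^ α / Q {a} ^ (α - 1) = ∞ := by
      refine ENNReal.tsum_eq_top_of_eq_top ⟨a, ?_⟩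
      rw [hQ, ENNReal.zero_rpow_of_pos hα', ENNReal.div_zero]
      intro h
      rcases ENNReal.rpow_eq_zero_iff.1 h with h | h
      · exact hP h.1
      · linarith [h.2]
    rw [this, ENNReal.top_rpow_of_pos (by positivity)]

end

end MSA

/-!
Convexity bounds the loss of the combination `ĝ_z` pointwise by the combination of the losses `U k`
of the predictors. As the weights are `z_k Q̂(k | x) / ∑ j, z_j Q̂(j | x)`, integrating this against
`∑ k, z_k Q̂(k) D̂_k` cancels the denominator and gives, for every `z` in the simplex,
`∑ k, z_k Q̂(k) 𝓛(D̂_k, ĝ_z) ≤ ∑ k, z_k Q̂(k) 𝓛(D̂_k, h_k)`. The right-hand side is at most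
`(∑ k, z_k Q̂(k)) E` with `E = max_k 𝓛(D̂_k, h_k)`. The functions `z ↦ 𝓛(D̂_k, ĝ_z) - E` are continuous
on the simplex, and a weighted mean of them, with weights proportional to `z_k Q̂(k)`, is never
positive. The map that Nash used for equilibria then has a fixed point at which all of them are
nonpositive (`exists_mem_stdSimplex_forall_nonpos`). This `z` does not depend on `α` or on the target
(`MSA.exists_forall_lintegral_estJoint_le`).

The remaining argument is change of measure by Hölder's inequality (`MSA.lintegral_le_expRenyi`): if
`0 ≤ g ≤ M`, then `∫ g dP ≤ (d_α(P ‖ Q) ∫ g dQ)^(1 - 1/α) M^(1/α)`. From `D̂_k` to `D_k` in order `α` it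
shows `E ≤ ε̂`, for all `α` at once. From `D_k` to `D̂_k` in order `2α - 1`, and from the target to
a mixture of the `D_k` in order `2α`, it turns the bound `ε̂` on the `D̂_k` into the claim
(`MSA.lintegral_le_guaranteeBound`). Of `δ` only its positivity is used: `ε̂ + δ ≠ 0` keeps a product
`0 * ∞` from occurring when a divergence is infinite.

Brouwer's theorem for the simplex, `exists_fixedPoint_stdSimplex`, is derived from Scarf's
combinatorial lemma, `exists_isDominant_image_eq_univ`, which is a parity argument about finitely many
linear orders and needs no triangulations. It is applied to a grid in the simplex ordered by each
coordinate: a dominant set of grid points has diameter of the order of the mesh, so if a grid point is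
coloured by a coordinate that the map does not decrease, a dominant set with all colours is close to
a fixed point.
-/

/-! ### Scarf's lemma -/

section Scarf

variable {V I α : Type*} [LinearOrder α]

/-- Given a family of orders on `V`, the `i`-th being the one induced by `f i`, a finite set `S` is
dominant if no point lies, for all `i`, strictly above the `i`-th minimum of `S`. -/
def IsDominant (f : I → V → α) (S : Finset V) : Prop :=
  ∀ y, ∃ i, ∀ x ∈ S, f i y ≤ f i x

theorem IsDominant.mono {f : I → V → α} {S T : Finset V} (hS : IsDominant f S) (h : T ⊆ S) :
    IsDominant f T := fun y => (hS y).imp fun _ hi x hx => hi x (h hx)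

variable [DecidableEq V] [Fintype I] [DecidableEq I]

/-- A set of `|I|` points that misses a colour contains an even number of points whose removal
leaves exactly the colours other than `i₀`. -/
theorem even_card_erase_image_eq {S : Finset V} (hS : S.card = Fintype.card I) (c : V → I) (i₀ : I)
    (hfull : S.image c ≠ Finset.univ) :
    Even (S.filter fun x => (S.erase x).image c = Finset.univ.erase i₀).card := by
  rcases Finset.eq_empty_or_nonempty
    (S.filter fun x => (S.erase x).image c = Finset.univ.erase i₀) with h0 | ⟨x₀, hx₀⟩
  · simp [h0]
  rw [Finset.mem_filter] at hx₀
  have hcardI : (Finset.univ.erase i₀).card + 1 = Fintype.card I := by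
    rw [Finset.card_erase_add_one (Finset.mem_univ _), Finset.card_univ]
  have himg : S.image c = Finset.univ.erase i₀ := by
    refine Finset.Subset.antisymm ?_ ?_
    · intro i hi
      refine Finset.mem_erase.2 ⟨?_, Finset.mem_univ _⟩
      rintro rfl
      refine hfull (Finset.eq_univ_of_forall fun j => ?_)
      rcases eq_or_ne j i with rfl | hj
      · exact hi
      · have : j ∈ (S.erase x₀).image c := by rw [hx₀.2]; simp [hj]
        exact Finset.image_subset_image (Finset.erase_subset _ _) this
    · rw [← hx₀.2]
      exact Finset.image_subset_image (Finset.erase_subset _ _)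
  obtain ⟨x, hx, y, hy, hxy, hc⟩ := Finset.exists_ne_map_eq_of_card_lt_of_maps_to
    (s := S) (t := Finset.univ.erase i₀) (f := c) (by omega)
    (fun z hz => himg ▸ Finset.mem_image_of_mem c hz)
  have hgood : ∀ x ∈ S, ∀ y ∈ S, x ≠ y → c x = c y →
      (S.erase x).image c = Finset.univ.erase i₀ := by
    intro x hx y hy hxy hc
    rw [← himg]
    refine Finset.Subset.antisymm (Finset.image_subset_image (Finset.erase_subset _ _)) ?_
    intro i hi
    obtain ⟨z, hz, rfl⟩ := Finset.mem_image.1 hi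
    rcases eq_or_ne z x with rfl | hzx
    · exact Finset.mem_image.2 ⟨y, Finset.mem_erase.2 ⟨hxy.symm, hy⟩, hc.symm⟩
    · exact Finset.mem_image_of_mem _ (Finset.mem_erase.2 ⟨hzx, hz⟩)
  have : (S.filter fun x => (S.erase x).image c = Finset.univ.erase i₀) = {x, y} := by
    ext z
    simp only [Finset.mem_filter, Finset.mem_insert, Finset.mem_singleton]
    constructor
    · rintro ⟨hz, hz'⟩
      by_contra! hne
      have hinj : Set.InjOn c (S.erase z : Finset V) := by
        refine Finset.card_image_iff.1 ?_
        rw [hz', Finset.card_erase_of_mem hz]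
        omega
      exact hxy (hinj (by simp [hne.1.symm, hx]) (by simp [hne.2.symm, hy]) hc)
    · rintro (rfl | rfl)
      · exact ⟨hx, hgood z hx y hy hxy hc⟩
      · exact ⟨hy, hgood z hy x hx hxy.symm hc.symm⟩
  rw [this, Finset.card_pair hxy]
  exact even_two

variable [Fintype V]

/-- The points that lie above `m j` in all orders except possibly the `c`-th. -/
def aboveExcept (f : I → V → α) (m : I → V) (c : I) : Finset V :=
  Finset.univ.filter fun y => ∀ j, j ≠ c → f j (m j) < f j y

/-- A dominant set with one element less than there are orders extends to a dominant set in at most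
two ways: two indices `a ≠ b` share their minimum, and the new point is either the `a`-th maximum of
the points above the other minima, or the `b`-th. -/
theorem IsDominant.exists_extension_iff {f : I → V → α} (hf : ∀ i, Function.Injective (f i))
    {τ : Finset V} (hτ : IsDominant f τ) (hcard : τ.card + 1 = Fintype.card I)
    {m : I → V} (hm : ∀ i, m i ∈ τ) (hmin : ∀ i, ∀ x ∈ τ, f i (m i) ≤ f i x) :
    ∃ a b : I, a ≠ b ∧ ∀ x, (x ∉ τ ∧ IsDominant f (insert x τ)) ↔
      (x ∈ aboveExcept f m a ∧ ∀ y ∈ aboveExcept f m a, f a y ≤ f a x) ∨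
      (x ∈ aboveExcept f m b ∧ ∀ y ∈ aboveExcept f m b, f b y ≤ f b x) := by
  have hsurj : ∀ x ∈ τ, ∃ i, m i = x := by
    intro x hx
    obtain ⟨i, hi⟩ := hτ x
    exact ⟨i, hf i (le_antisymm (hmin i x hx) (hi _ (hm i)))⟩
  obtain ⟨a, -, b, -, hab, hmab⟩ := Finset.exists_ne_map_eq_of_card_lt_of_maps_to
    (s := Finset.univ) (t := τ) (f := m) (by rw [Finset.card_univ]; omega) (fun i _ => hm i)
  have himg : ∀ c, (∃ d, d ≠ c ∧ m d = m c) → (Finset.univ.erase c).image m = τ := by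
    rintro c ⟨d, hdc, hd⟩
    ext x
    simp only [Finset.mem_image, Finset.mem_erase, Finset.mem_univ, and_true]
    constructor
    · rintro ⟨i, -, rfl⟩
      exact hm i
    · intro hx
      obtain ⟨i, rfl⟩ := hsurj x hx
      rcases eq_or_ne i c with rfl | h
      · exact ⟨d, hdc, hd⟩
      · exact ⟨i, h, rfl⟩
  have hinj : ∀ c, (∃ d, d ≠ c ∧ m d = m c) →
      Set.InjOn m (Finset.univ.erase c : Finset I) := by
    intro c hc
    refine Finset.card_image_iff.1 ?_
    rw [himg c hc, Finset.card_erase_of_mem (Finset.mem_univ _), Finset.card_univ]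
    omega
  have hsuff : ∀ c, (∃ d, d ≠ c ∧ m d = m c) → ∀ x, (x ∈ aboveExcept f m c ∧
      ∀ y ∈ aboveExcept f m c, f c y ≤ f c x) → x ∉ τ ∧ IsDominant f (insert x τ) := by
    rintro c hc x ⟨hx, hmax⟩
    simp only [aboveExcept, Finset.mem_filter, Finset.mem_univ, true_and] at hx hmax
    constructor
    · intro hxτ
      rw [← himg c hc, Finset.mem_image] at hxτ
      obtain ⟨i, hi, rfl⟩ := hxτ
      exact lt_irrefl _ (hx i (Finset.ne_of_mem_erase hi))
    · intro y
      by_cases hy : ∃ j, j ≠ c ∧ f j y ≤ f j (m j)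
      · obtain ⟨j, hj, hjy⟩ := hy
        refine ⟨j, fun z hz => ?_⟩
        rcases Finset.mem_insert.1 hz with rfl | hz
        · exact hjy.trans (hx j hj).le
        · exact hjy.trans (hmin j z hz)
      · push Not at hy
        obtain ⟨i, hi⟩ := hτ x
        have hic : i = c := by
          by_contra h
          exact absurd (hx i h) (not_lt.2 (hi _ (hm i)))
        subst hic
        refine ⟨i, fun z hz => ?_⟩
        rcases Finset.mem_insert.1 hz with rfl | hz
        · exact hmax y hy
        · exact (hmax y hy).trans (hi z hz)
  refine ⟨a, b, hab, fun x => ⟨?_, ?_⟩⟩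
  · rintro ⟨hxτ, hdom⟩
    obtain ⟨c, hc⟩ := hdom x
    have hlt : ∀ j, j ≠ c → f j (m j) < f j x := by
      -- every element of `τ` is still the minimum of `insert x τ` for some index other than `c`
      have hτ' : τ ⊆ (Finset.univ.erase c).image m := by
        intro z hz
        obtain ⟨i, hi⟩ := hdom z
        have hzi : m i = z := hf i (le_antisymm (hmin i z hz)
          (hi _ (Finset.mem_insert_of_mem (hm i))))
        refine Finset.mem_image.2 ⟨i, Finset.mem_erase.2 ⟨?_, Finset.mem_univ _⟩, hzi⟩
        rintro rfl
        have : x = z := hf i (le_antisymm (hc z (Finset.mem_insert_of_mem hz))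
          (hi x (Finset.mem_insert_self _ _)))
        exact hxτ (this ▸ hz)
      have hinjc : Set.InjOn m (Finset.univ.erase c : Finset I) := by
        refine Finset.card_image_iff.1 (le_antisymm Finset.card_image_le ?_)
        refine le_trans ?_ (Finset.card_le_card hτ')
        rw [Finset.card_erase_of_mem (Finset.mem_univ _), Finset.card_univ]
        omega
      intro j hj
      obtain ⟨i, hi⟩ := hdom (m j)
      have hmij : m i = m j := hf i (le_antisymm (hmin i _ (hm j))
        (hi _ (Finset.mem_insert_of_mem (hm i))))
      have hic : i ≠ c := by
        rintro rfl
        have : x = m j := hf i (le_antisymm (hc _ (Finset.mem_insert_of_mem (hm j)))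
          (hi x (Finset.mem_insert_self _ _)))
        exact hxτ (this ▸ hm j)
      have hij : i = j := hinjc (by simp [hic]) (by simp [hj]) hmij
      subst hij
      exact lt_of_le_of_ne (hi x (Finset.mem_insert_self _ _))
        fun h => hxτ (hf i h ▸ hm i)
    have hx : x ∈ aboveExcept f m c := by simpa [aboveExcept] using hlt
    have hmax : ∀ y ∈ aboveExcept f m c, f c y ≤ f c x := by
      intro y hy
      simp only [aboveExcept, Finset.mem_filter, Finset.mem_univ, true_and] at hy
      obtain ⟨i, hi⟩ := hdom y
      have hic : i = c := by
        by_contra h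
        exact absurd (hy i h) (not_lt.2 (hi _ (Finset.mem_insert_of_mem (hm i))))
      subst hic
      exact hi x (Finset.mem_insert_self _ _)
    have hcab : c = a ∨ c = b := by
      by_contra! h
      -- `a` and `b` have the same minimum, so the indices other than `b` and `c` would suffice to
      -- produce all of `τ`, and there are too few of them
      have hτ' : τ ⊆ ((Finset.univ.erase c).erase b).image m := by
        intro z hz
        obtain ⟨i, hi⟩ := hdom z
        have hzi : m i = z := hf i (le_antisymm (hmin i z hz)
          (hi _ (Finset.mem_insert_of_mem (hm i))))
        have hic : i ≠ c := by
          rintro rfl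
          have : x = z := hf i (le_antisymm (hc z (Finset.mem_insert_of_mem hz))
            (hi x (Finset.mem_insert_self _ _)))
          exact hxτ (this ▸ hz)
        rcases eq_or_ne i b with rfl | hib
        · exact Finset.mem_image.2 ⟨a, by simp [hab, h.1.symm], hmab.trans hzi⟩
        · exact Finset.mem_image.2 ⟨i, by simp [hib, hic], hzi⟩
      have h3 := (Finset.card_le_card hτ').trans Finset.card_image_le
      rw [Finset.card_erase_of_mem (by simp [h.2.symm]),
        Finset.card_erase_of_mem (Finset.mem_univ _), Finset.card_univ] at h3
      have : 0 < τ.card := Finset.card_pos.2 ⟨_, hm a⟩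
      omega
    rcases hcab with rfl | rfl
    · exact Or.inl ⟨hx, hmax⟩
    · exact Or.inr ⟨hx, hmax⟩
  · rintro (h | h)
    · exact hsuff a ⟨b, hab.symm, hmab.symm⟩ x h
    · exact hsuff b ⟨a, hab, hmab⟩ x h

open Classical in
/-- If moreover every `aboveExcept` set is nonempty, there are exactly two ways to extend. -/
theorem IsDominant.card_extension {f : I → V → α} (hf : ∀ i, Function.Injective (f i))
    {τ : Finset V} (hτ : IsDominant f τ) (hcard : τ.card + 1 = Fintype.card I)
    {m : I → V} (hm : ∀ i, m i ∈ τ) (hmin : ∀ i, ∀ x ∈ τ, f i (m i) ≤ f i x)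
    (hne : ∀ i, (aboveExcept f m i).Nonempty) :
    (Finset.univ.filter fun x => x ∉ τ ∧ IsDominant f (insert x τ)).card = 2 := by
  obtain ⟨a, b, hab, h⟩ := hτ.exists_extension_iff hf hcard hm hmin
  obtain ⟨xa, hxa, hxa'⟩ := Finset.exists_max_image _ (f a) (hne a)
  obtain ⟨xb, hxb, hxb'⟩ := Finset.exists_max_image _ (f b) (hne b)
  have hne : xa ≠ xb := by
    rintro rfl
    obtain ⟨i, hi⟩ := hτ xa
    simp only [aboveExcept, Finset.mem_filter, Finset.mem_univ, true_and] at hxa hxb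
    rcases eq_or_ne i a with rfl | hia
    · exact absurd (hxb i hab) (not_lt.2 (hi _ (hm i)))
    · exact absurd (hxa i hia) (not_lt.2 (hi _ (hm i)))
  rw [← Finset.card_pair hne]
  congr 1
  ext x
  simp only [Finset.mem_filter, Finset.mem_univ, true_and, Finset.mem_insert,
    Finset.mem_singleton, h]
  constructor
  · rintro (⟨h1, h2⟩ | ⟨h1, h2⟩)
    · exact Or.inl (hf a (le_antisymm (hxa' _ h1) (h2 _ hxa)))
    · exact Or.inr (hf b (le_antisymm (hxb' _ h1) (h2 _ hxb)))
  · rintro (rfl | rfl)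
    · exact Or.inl ⟨hxa, hxa'⟩
    · exact Or.inr ⟨hxb, hxb'⟩

open Classical in
/-- **Scarf's lemma.** Let `V` carry one linear order for each `i : I`, and contain a slack point
`s i` for each `i`, which is the least one in order `i` and lies above all points other than slack
points in the other orders. If `V` is coloured so that `s i` has colour `i`, then some dominant set
carries all colours. Incidences of dominant sets of `|I|` points with their facets that carry exactly
the colours other than `i₀` are counted modulo two: the facet formed by the slack points other than
`s i₀` extends in one way, all the others in two ways. -/
theorem exists_isDominant_image_eq_univ {f : I → V → α} (hf : ∀ i, Function.Injective (f i))
    {s : I → V} (hbot : ∀ i y, f i (s i) ≤ f i y)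
    (htop : ∀ i j, j ≠ i → ∀ y, (∀ k, y ≠ s k) → f j y < f j (s i))
    {v₀ : V} (hv₀ : ∀ k, v₀ ≠ s k) {c : V → I} (hc : ∀ i, c (s i) = i) [Nonempty I] :
    ∃ S : Finset V, IsDominant f S ∧ S.image c = Finset.univ := by
  by_contra! hcon
  obtain ⟨i₀⟩ := ‹Nonempty I›
  have hs : Function.Injective s := fun i j h => by rw [← hc i, h, hc j]
  -- the incidences between dominant sets `S` of size `|I|` and their facets `S.erase x` whose
  -- colours are exactly those other than `i₀`
  let P : Finset (Finset V × V) := Finset.univ.filter fun q =>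
    q.2 ∈ q.1 ∧ IsDominant f q.1 ∧ q.1.card = Fintype.card I ∧
      (q.1.erase q.2).image c = Finset.univ.erase i₀
  have heven : Even P.card := by
    rw [Finset.card_eq_sum_card_fiberwise (f := Prod.fst) (t := Finset.univ)
      (fun _ _ => Finset.mem_coe.2 (Finset.mem_univ _))]
    refine Finset.even_sum _ fun S _ => ?_
    by_cases hS : IsDominant f S ∧ S.card = Fintype.card I
    · have hE := even_card_erase_image_eq hS.2 c i₀ (hcon S hS.1)
      suffices h : (P.filter fun q => q.1 = S).card =
          (S.filter fun x => (S.erase x).image c = Finset.univ.erase i₀).card by rwa [h]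
      refine Finset.card_bij (fun q _ => q.2) ?_ ?_ ?_
      · rintro ⟨S', x⟩ hq
        simp only [P, Finset.mem_filter, Finset.mem_univ, true_and] at hq ⊢
        obtain ⟨⟨h1, -, -, h4⟩, rfl⟩ := hq
        exact ⟨h1, h4⟩
      · rintro ⟨S', x⟩ hq ⟨S'', x'⟩ hq' h
        simp only [Finset.mem_filter] at hq hq'
        exact Prod.ext (hq.2.trans hq'.2.symm) h
      · intro x hx
        simp only [Finset.mem_filter] at hx
        exact ⟨(S, x), by simp [P, hx.1, hx.2, hS.1, hS.2], rfl⟩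
    · have : P.filter (fun q => q.1 = S) = ∅ := by
        refine Finset.filter_eq_empty_iff.2 ?_
        rintro ⟨S', x⟩ hq rfl
        simp only [P, Finset.mem_filter, Finset.mem_univ, true_and] at hq
        exact hS ⟨hq.2.1, hq.2.2.1⟩
      simp [this]
  have hcardI : (Finset.univ.erase i₀).card + 1 = Fintype.card I := by
    rw [Finset.card_erase_add_one (Finset.mem_univ _), Finset.card_univ]
  let τ₀ : Finset V := (Finset.univ.erase i₀).image s
  have hfib : ∀ τ : Finset V, (P.filter fun q => q.1.erase q.2 = τ).card =
      if τ.image c = Finset.univ.erase i₀ ∧ τ.card + 1 = Fintype.card I then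
        (Finset.univ.filter fun x => x ∉ τ ∧ IsDominant f (insert x τ)).card else 0 := by
    intro τ
    split_ifs with h
    · refine Finset.card_bij (fun q _ => q.2) ?_ ?_ ?_
      · rintro ⟨S, x⟩ hq
        simp only [P, Finset.mem_filter, Finset.mem_univ, true_and] at hq ⊢
        obtain ⟨⟨h1, h2, -, -⟩, rfl⟩ := hq
        exact ⟨Finset.notMem_erase _ _, by rwa [Finset.insert_erase h1]⟩
      · rintro ⟨S, x⟩ hq ⟨S', x'⟩ hq' hxx
        simp only [P, Finset.mem_filter, Finset.mem_univ, true_and] at hq hq' hxx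
        subst hxx
        rw [Prod.mk.injEq, ← Finset.insert_erase hq.1.1, ← Finset.insert_erase hq'.1.1, hq.2, hq'.2]
        exact ⟨rfl, rfl⟩
      · intro x hx
        simp only [Finset.mem_filter, Finset.mem_univ, true_and] at hx
        refine ⟨(insert x τ, x), ?_, rfl⟩
        simp only [P, Finset.mem_filter, Finset.mem_univ, true_and, Finset.erase_insert hx.1,
          and_true]
        exact ⟨Finset.mem_insert_self _ _, hx.2,
          by rw [Finset.card_insert_of_notMem hx.1, h.2], h.1⟩
    · refine Finset.card_eq_zero.2 (Finset.filter_eq_empty_iff.2 ?_)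
      rintro ⟨S, x⟩ hq rfl
      simp only [P, Finset.mem_filter, Finset.mem_univ, true_and] at hq
      exact h ⟨hq.2.2.2, by rw [Finset.card_erase_add_one hq.1, hq.2.2.1]⟩
  have hodd : Odd P.card := by
    rw [Finset.card_eq_sum_card_fiberwise (f := fun q => q.1.erase q.2) (t := Finset.univ)
      (fun _ _ => Finset.mem_coe.2 (Finset.mem_univ _)),
      ← Finset.sum_erase_add _ _ (Finset.mem_univ τ₀)]
    refine Even.add_odd (Finset.even_sum _ fun τ hτ => ?_) ?_
    · rw [hfib]
      split_ifs with h
      swap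
      · simp
      -- a facet other than `τ₀` contains a point that is not slack
      obtain ⟨v, hv, hvs⟩ : ∃ v ∈ τ, ∀ k, v ≠ s k := by
        by_contra! hall
        refine Finset.ne_of_mem_erase hτ ?_
        refine Finset.eq_of_subset_of_card_le (fun x hx => ?_) ?_
        · obtain ⟨k, rfl⟩ := hall x hx
          refine Finset.mem_image_of_mem _ ?_
          rw [← h.1]
          exact Finset.mem_image.2 ⟨_, hx, hc k⟩
        · rw [Finset.card_image_of_injective _ hs]
          omega
      by_cases hd : IsDominant f τ
      · have hmin : ∀ i, ∃ x ∈ τ, ∀ y ∈ τ, f i x ≤ f i y := fun i =>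
          Finset.exists_min_image τ (f i) ⟨v, hv⟩
        choose m hm hm' using hmin
        rw [hd.card_extension hf h.2 hm hm' fun i => ⟨s i, ?_⟩]
        · exact even_two
        · simp only [aboveExcept, Finset.mem_filter, Finset.mem_univ, true_and]
          exact fun j hj => (hm' j v hv).trans_lt (htop i j hj v hvs)
      · rw [Finset.filter_eq_empty_iff.2]
        · simp
        · rintro x - ⟨-, hx⟩
          exact hd (hx.mono (Finset.subset_insert _ _))
    · rw [hfib, if_pos]
      swap
      · refine ⟨?_, by rw [Finset.card_image_of_injective _ hs, hcardI]⟩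
        ext i
        simp [τ₀, hc]
      obtain ⟨w, hw, hw'⟩ := Finset.exists_max_image
        (Finset.univ.filter fun x : V => ∀ k, x ≠ s k) (f i₀) ⟨v₀, by simpa using hv₀⟩
      simp only [Finset.mem_filter, Finset.mem_univ, true_and] at hw hw'
      suffices h : (Finset.univ.filter fun x => x ∉ τ₀ ∧ IsDominant f (insert x τ₀)) = {w} by
        rw [h]; simp
      have hmem : ∀ i, i ≠ i₀ → s i ∈ τ₀ := fun i hi =>
        Finset.mem_image_of_mem _ (by simp [hi])
      -- a point that is not slack can be dominated only in the order `i₀`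
      have hidx : ∀ y, (∀ k, y ≠ s k) → ∀ i, (∀ x ∈ τ₀, f i y ≤ f i x) → i = i₀ := by
        intro y hy i hi
        by_contra hne
        exact hy i (hf i (le_antisymm (hi _ (hmem i hne)) (hbot i y)))
      ext x
      simp only [Finset.mem_filter, Finset.mem_univ, true_and, Finset.mem_singleton]
      constructor
      · rintro ⟨hx, hd⟩
        obtain ⟨i, hi⟩ := hd w
        obtain rfl := hidx w hw i fun z hz => hi z (Finset.mem_insert_of_mem hz)
        have hxs : ∀ k, x ≠ s k := by
          rintro k rfl
          rcases eq_or_ne k i with rfl | hk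
          · exact hw k (hf k (le_antisymm (hi _ (Finset.mem_insert_self _ _)) (hbot k w)))
          · exact hx (hmem k hk)
        exact hf i (le_antisymm (hw' x hxs) (hi x (Finset.mem_insert_self _ _)))
      · rintro rfl
        refine ⟨fun hx => ?_, fun y => ?_⟩
        · obtain ⟨k, -, hk⟩ := Finset.mem_image.1 hx
          exact hw k hk.symm
        · by_cases hy : ∃ k, y = s k
          · obtain ⟨k, rfl⟩ := hy
            exact ⟨k, fun z _ => hbot k z⟩
          · push Not at hy
            refine ⟨i₀, fun z hz => ?_⟩
            rcases Finset.mem_insert.1 hz with rfl | hz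
            · exact hw' y hy
            · obtain ⟨k, hk, rfl⟩ := Finset.mem_image.1 hz
              exact (htop k i₀ (Finset.ne_of_mem_erase hk).symm y hy).le
  exact (Nat.not_even_iff_odd.2 hodd) heven

end Scarf

/-! ### Brouwer's fixed point theorem for the standard simplex -/

section Brouwer

variable {I : Type*} [Fintype I]

/-- Scarf's lemma on the grid of points with natural coordinates of sum `N`. If the grid is coloured
by `I`, there is a grid point `b` such that, for every `i`, either the `i`-th coordinate of `b` is at
most `|I|` or some grid point of colour `i` differs from `b` by at most `|I|` in each coordinate. The
first case is that of the indices whose slack point lies in the dominant set. -/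
theorem exists_grid_point_near_colours [DecidableEq I] [Nonempty I] (N : ℕ) (c : (I → ℕ) → I) :
    ∃ b : I → ℕ, ∑ i, b i = N ∧ ∀ i, b i ≤ Fintype.card I ∨
      ∃ g : I → ℕ, ∑ i, g i = N ∧ c g = i ∧
        ∀ j, b j ≤ g j + Fintype.card I ∧ g j ≤ b j + Fintype.card I := by
  classical
  let T := {g : I → ℕ // g ∈ (Finset.univ : Finset I).piAntidiag N}
  have hT : ∀ g : I → ℕ, g ∈ (Finset.univ : Finset I).piAntidiag N ↔ ∑ i, g i = N := by
    intro g; simp [Finset.mem_piAntidiag]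
  let pos : I → T ⊕ I → ℤ := fun i v => Sum.elim (fun g : T => (g.1 i : ℤ))
    (fun k => if i = k then -1 else N + 1) v
  -- ties between coordinates are broken by an arbitrary enumeration
  let f : I → T ⊕ I → ℤ ×ₗ Fin (Fintype.card (T ⊕ I)) := fun i v =>
    toLex (pos i v, Fintype.equivFin _ v)
  have hfle : ∀ i v w, f i v ≤ f i w → pos i v ≤ pos i w := by
    intro i v w h
    rcases Prod.Lex.toLex_le_toLex.1 h with h | h
    · exact h.le
    · exact h.1.le
  have hflt : ∀ i v w, pos i v < pos i w → f i v < f i w := fun i v w h =>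
    Prod.Lex.toLex_lt_toLex.2 (Or.inl h)
  have hinj : ∀ i, Function.Injective (f i) := by
    intro i v w h
    have := congrArg (fun q => (ofLex q).2) h
    exact (Fintype.equivFin _).injective this
  have hgN : ∀ (g : T) i, g.1 i ≤ N := fun g i =>
    (Finset.single_le_sum (f := g.1) (fun _ _ => Nat.zero_le _) (Finset.mem_univ i)).trans_eq
      ((hT g.1).1 g.2)
  obtain ⟨i₁⟩ := ‹Nonempty I›
  have hv₀ : (Pi.single i₁ N : I → ℕ) ∈ (Finset.univ : Finset I).piAntidiag N := by
    rw [hT]; simp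
  have : Nonempty I := ⟨i₁⟩
  -- the slack point of `i` has coordinate `-1` in direction `i` and `N + 1` in all others
  obtain ⟨S, hS, hfull⟩ := exists_isDominant_image_eq_univ (f := f) hinj (s := Sum.inr)
    (c := Sum.elim (fun g : T => c g.1) id) (v₀ := Sum.inl ⟨_, hv₀⟩) (by
      intro i y
      by_cases hy : y = Sum.inr i
      · rw [hy]
      refine (hflt _ _ _ ?_).le
      rcases y with g | k
      · simp only [pos, Sum.elim_inl, Sum.elim_inr, if_true]; omega
      · have : i ≠ k := fun h => hy (h ▸ rfl)
        simp only [pos, Sum.elim_inr, if_true, this, if_false]; omega) (by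
      intro i j hji y hy
      refine hflt _ _ _ ?_
      rcases y with g | k
      · have := hgN g j
        simp only [pos, Sum.elim_inl, Sum.elim_inr, hji, if_false]; omega
      · exact absurd rfl (hy k)) (by simp) (by simp)
  let C : Finset I := Finset.univ.filter fun i => Sum.inr i ∉ S
  have hcol : ∀ i ∈ C, ∃ g : T, Sum.inl g ∈ S ∧ c g.1 = i := by
    intro i hi
    have : i ∈ S.image (Sum.elim (fun g : T => c g.1) id) := by rw [hfull]; simp
    obtain ⟨x, hx, hxi⟩ := Finset.mem_image.1 this
    rcases x with g | k
    · exact ⟨g, hx, hxi⟩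
    · obtain rfl : k = i := hxi
      simp only [C, Finset.mem_filter] at hi
      exact absurd hx hi.2
  have hdomC : ∀ y : T, ∃ i ∈ C, ∀ g : T, Sum.inl g ∈ S → y.1 i ≤ g.1 i := by
    intro y
    obtain ⟨i, hi⟩ := hS (Sum.inl y)
    refine ⟨i, ?_, fun g hg => ?_⟩
    · simp only [C, Finset.mem_filter, Finset.mem_univ, true_and]
      intro hiS
      have := hfle _ _ _ (hi _ hiS)
      simp only [pos, Sum.elim_inl, Sum.elim_inr, if_true] at this
      omega
    · have := hfle _ _ _ (hi _ hg)
      simpa [pos] using this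
  obtain ⟨i₂, hi₂, -⟩ := hdomC ⟨_, hv₀⟩
  obtain ⟨b, hb, -⟩ := hcol i₂ hi₂
  let σ : Finset T := Finset.univ.filter fun g => Sum.inl g ∈ S
  have hmin : ∀ i, ∃ g ∈ σ, ∀ g' ∈ σ, g.1 i ≤ g'.1 i := fun i =>
    Finset.exists_min_image σ (fun g => g.1 i) ⟨b, by simp [σ, hb]⟩
  choose m hm hm' using hmin
  have hmem : ∀ g, Sum.inl g ∈ S → g ∈ σ := fun g hg => by simp [σ, hg]
  -- otherwise some grid point would lie above all the minima
  have hsum : N < ∑ i ∈ C, ((m i).1 i + 1) := by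
    by_contra! hle
    let y : I → ℕ := fun i => (if i ∈ C then (m i).1 i + 1 else 0) +
      (if i = i₂ then N - ∑ i ∈ C, ((m i).1 i + 1) else 0)
    have hy : ∑ i, y i = N := by
      simp only [y, Finset.sum_add_distrib, Finset.sum_ite_mem, Finset.univ_inter,
        Finset.sum_ite_eq', Finset.mem_univ, if_true]
      simp only [Finset.sum_add_distrib] at hle ⊢
      omega
    obtain ⟨i, hi, hyi⟩ := hdomC ⟨y, (hT y).2 hy⟩
    have h1 := hyi (m i) (by simpa [σ] using hm i)
    simp only [y, hi, if_true] at h1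
    omega
  rw [Finset.sum_add_distrib, Finset.sum_const, smul_eq_mul, mul_one] at hsum
  have hCn : C.card ≤ Fintype.card I := Finset.card_le_univ C
  have hle : ∀ g, Sum.inl g ∈ S → ∀ i, (i ∈ C → g.1 i ≤ (m i).1 i + Fintype.card I) ∧
      (i ∉ C → g.1 i ≤ Fintype.card I) := by
    intro g hg i
    have hgs := (hT g.1).1 g.2
    rw [← Finset.sum_add_sum_compl C] at hgs
    have hmono : ∀ D : Finset I, ∑ i ∈ D, (m i).1 i ≤ ∑ i ∈ D, g.1 i := fun D =>
      Finset.sum_le_sum fun j _ => hm' j g (hmem g hg)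
    constructor
    · intro hi
      have h1 := hmono (C.erase i)
      have h2 := Finset.add_sum_erase C g.1 hi
      have h3 := Finset.add_sum_erase C (fun i => (m i).1 i) hi
      omega
    · intro hi
      have h1 := hmono C
      have h2 := Finset.single_le_sum (f := g.1) (s := Cᶜ) (fun _ _ => Nat.zero_le _)
        (Finset.mem_compl.2 hi)
      omega
  refine ⟨b.1, (hT b.1).1 b.2, fun i => ?_⟩
  by_cases hi : i ∈ C
  · obtain ⟨g, hg, hgi⟩ := hcol i hi
    refine Or.inr ⟨g.1, (hT g.1).1 g.2, hgi, fun j => ?_⟩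
    have h1 := hle b hb j
    have h2 := hle g hg j
    have h3 := hm' j g (hmem g hg)
    have h4 := hm' j b (hmem b hb)
    by_cases hj : j ∈ C
    · have := h1.1 hj
      have := h2.1 hj
      omega
    · have := h1.2 hj
      have := h2.2 hj
      omega
  · exact Or.inl ((hle b hb i).2 hi)

/-- A continuous self-map of the simplex has points that it decreases by at most `γ` in each
coordinate. -/
theorem exists_le_add_of_mapsTo_stdSimplex [Nonempty I] {F : (I → ℝ) → I → ℝ}
    (hF : ContinuousOn F (stdSimplex ℝ I)) (hmap : Set.MapsTo F (stdSimplex ℝ I) (stdSimplex ℝ I))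
    {γ : ℝ} (hγ : 0 < γ) : ∃ z ∈ stdSimplex ℝ I, ∀ i, z i ≤ F z i + γ := by
  classical
  have huc := (isCompact_stdSimplex ℝ I).uniformContinuousOn_of_continuous hF
  obtain ⟨η, hη, hηF⟩ := Metric.uniformContinuousOn_iff.1 huc (γ / 2) (half_pos hγ)
  obtain ⟨N, hN⟩ := exists_nat_gt ((Fintype.card I : ℝ) / min η (γ / 2))
  have hmin : 0 < min η (γ / 2) := lt_min hη (half_pos hγ)
  have hN0 : (0 : ℝ) < N := lt_of_le_of_lt (by positivity) hN
  have hsmall : (Fintype.card I : ℝ) / N < min η (γ / 2) := by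
    rw [div_lt_iff₀ hmin] at hN
    rw [div_lt_iff₀ hN0]
    linarith
  let e : (I → ℕ) → I → ℝ := fun g i => (g i : ℝ) / N
  have he : ∀ g : I → ℕ, ∑ i, g i = N → e g ∈ stdSimplex ℝ I := by
    intro g hg
    refine ⟨fun i => by positivity, ?_⟩
    rw [← Finset.sum_div, ← Nat.cast_sum, hg, div_self hN0.ne']
  -- as coordinates sum to one before and after, some coordinate does not decrease; it is the colour
  have hcol : ∀ g : I → ℕ, ∃ i, ∑ i, g i = N → e g i ≤ F (e g) i := by
    intro g
    by_contra! h
    have hg := (h (Classical.arbitrary I)).1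
    have h1 := (hmap (he g hg)).2
    have h2 := (he g hg).2
    have := Finset.sum_lt_sum_of_nonempty (Finset.univ_nonempty (α := I)) fun i _ => (h i).2
    linarith
  choose c hc using hcol
  obtain ⟨b, hb, hnear⟩ := exists_grid_point_near_colours N c
  refine ⟨e b, he b hb, fun i => ?_⟩
  have hs2 : (Fintype.card I : ℝ) / N < γ / 2 := hsmall.trans_le (min_le_right _ _)
  rcases hnear i with h | ⟨g, hg, rfl, hgb⟩
  · have h1 : e b i ≤ (Fintype.card I : ℝ) / N := by
      simp only [e]
      gcongr
    have := (hmap (he b hb)).1 i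
    linarith
  · have hdist : ∀ j, e b j ≤ e g j + (Fintype.card I : ℝ) / N ∧
        e g j ≤ e b j + (Fintype.card I : ℝ) / N := by
      intro j
      simp only [e, ← add_div]
      exact ⟨by gcongr; exact_mod_cast (hgb j).1, by gcongr; exact_mod_cast (hgb j).2⟩
    have h1 : dist (e b) (e g) < η := by
      rw [dist_pi_lt_iff hη]
      intro j
      rw [Real.dist_eq]
      refine lt_of_le_of_lt ?_ (hsmall.trans_le (min_le_left _ _))
      rw [abs_le]
      constructor <;> linarith [(hdist j).1, (hdist j).2]
    have h2 := (dist_le_pi_dist (F (e b)) (F (e g)) (c g)).trans_lt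
      (hηF _ (he b hb) _ (he g hg) h1)
    rw [Real.dist_eq, abs_lt] at h2
    linarith [hc g hg, (hdist (c g)).1]

/-- **Brouwer's fixed point theorem** for the standard simplex. -/
theorem exists_fixedPoint_stdSimplex [Nonempty I] {F : (I → ℝ) → I → ℝ}
    (hF : ContinuousOn F (stdSimplex ℝ I))
    (hmap : Set.MapsTo F (stdSimplex ℝ I) (stdSimplex ℝ I)) :
    ∃ z ∈ stdSimplex ℝ I, F z = z := by
  classical
  let φ : (I → ℝ) → ℝ := fun z => ∑ i, max (z i - F z i) 0
  have hφ : ContinuousOn φ (stdSimplex ℝ I) := by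
    refine continuousOn_finsetSum _ fun i _ => ?_
    exact ContinuousOn.sup ((continuous_apply i).continuousOn.sub
      ((continuous_apply i).comp_continuousOn hF)) continuousOn_const
  obtain ⟨z, hz, hzmin⟩ := (isCompact_stdSimplex ℝ I).exists_isMinOn
    ⟨_, single_mem_stdSimplex ℝ (Classical.arbitrary I)⟩ hφ
  have hφz : φ z ≤ 0 := by
    refine le_of_forall_pos_le_add fun γ hγ => ?_
    have hn : (0 : ℝ) < Fintype.card I := by exact_mod_cast Fintype.card_pos
    obtain ⟨w, hw, hwF⟩ := exists_le_add_of_mapsTo_stdSimplex hF hmap (div_pos hγ hn)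
    refine (hzmin hw).trans ?_
    calc φ w ≤ ∑ _i : I, γ / Fintype.card I :=
          Finset.sum_le_sum fun i _ => max_le (by linarith [hwF i]) (by positivity)
      _ = 0 + γ := by
          rw [Finset.sum_const, Finset.card_univ, nsmul_eq_mul, mul_div_cancel₀ _ hn.ne', zero_add]
  have hle : ∀ i, z i ≤ F z i := by
    intro i
    have h1 := Finset.single_le_sum (f := fun i => max (z i - F z i) 0)
      (fun i _ => le_max_right _ _) (Finset.mem_univ i)
    linarith [le_max_left (z i - F z i) 0, h1.trans hφz]
  refine ⟨z, hz, funext fun i => ?_⟩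
  have hsum : ∑ i, z i = ∑ i, F z i := hz.2.trans (hmap hz).2.symm
  exact ((Finset.sum_eq_sum_iff_of_le fun i _ => hle i).1 hsum i (Finset.mem_univ i)).symm

/-- Let `G k` be continuous functions on the simplex. If no point `z` of the simplex has a
positive value of `∑ k, z k * q k * G k z`, where `q k > 0`, then the `G k` are simultaneously
nonpositive somewhere. -/
theorem exists_mem_stdSimplex_forall_nonpos [Nonempty I] {G : I → (I → ℝ) → ℝ}
    (hG : ∀ k, ContinuousOn (G k) (stdSimplex ℝ I)) {q : I → ℝ} (hq : ∀ k, 0 < q k)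
    (h : ∀ z ∈ stdSimplex ℝ I, ∑ k, z k * q k * G k z ≤ 0) :
    ∃ z ∈ stdSimplex ℝ I, ∀ k, G k z ≤ 0 := by
  -- the map used by Nash: it increases the weight of those `k` for which `G k z` is positive
  let s : (I → ℝ) → ℝ := fun z => ∑ k, max (G k z) 0
  have hs0 : ∀ z, 0 ≤ s z := fun z => Finset.sum_nonneg fun k _ => le_max_right _ _
  have hcont : ∀ k, ContinuousOn (fun z => max (G k z) 0) (stdSimplex ℝ I) := fun k =>
    ContinuousOn.sup (hG k) continuousOn_const
  obtain ⟨z, hz, hfix⟩ := exists_fixedPoint_stdSimplex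
    (F := fun z k => (z k + max (G k z) 0) / (1 + s z)) (by
      refine continuousOn_pi.2 fun k => ContinuousOn.div ?_ ?_ ?_
      · exact (continuous_apply k).continuousOn.add (hcont k)
      · exact continuousOn_const.add (continuousOn_finsetSum _ fun k _ => hcont k)
      · intro z _
        linarith [hs0 z]) (by
      intro z hz
      refine ⟨fun k => div_nonneg (add_nonneg (hz.1 k) (le_max_right _ _)) (by linarith [hs0 z]), ?_⟩
      rw [← Finset.sum_div, Finset.sum_add_distrib, hz.2]
      exact div_self (by linarith [hs0 z]))
  refine ⟨z, hz, ?_⟩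
  have hk : ∀ k, max (G k z) 0 = z k * s z := by
    intro k
    have := congrFun hfix k
    rw [div_eq_iff (by linarith [hs0 z])] at this
    linarith
  by_contra! hcon
  obtain ⟨k₀, hk₀⟩ := hcon
  have hs : 0 < s z := by
    refine lt_of_lt_of_le hk₀ ((le_max_left _ 0).trans ?_)
    exact Finset.single_le_sum (f := fun k => max (G k z) 0) (fun k _ => le_max_right _ _)
      (Finset.mem_univ k₀)
  have hpos : ∀ k, 0 ≤ z k * q k * G k z := by
    intro k
    rcases (hz.1 k).eq_or_lt with h0 | h0
    · rw [← h0]; simp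
    · have h1 : 0 < max (G k z) 0 := by rw [hk]; positivity
      have h2 : 0 < G k z := by simpa using h1
      have := hq k
      positivity
  have hz₀ : 0 < z k₀ := by
    have h1 := hk k₀
    rw [max_eq_left hk₀.le] at h1
    by_contra! h2
    nlinarith
  have h1 : 0 < z k₀ * q k₀ * G k₀ z := mul_pos (mul_pos hz₀ (hq k₀)) hk₀
  exact absurd (h z hz) (not_le.2 (Finset.sum_pos' (fun k _ => hpos k) ⟨k₀, Finset.mem_univ _, h1⟩))

end Brouwer

namespace MSA

/-! ### The discriminative combination -/

section Combination

variable {X : Type*} {p : ℕ} {Qhat : Fin p → X → ℝ}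

theorem sum_mul_pos_of_mem_stdSimplex {z : Fin p → ℝ} (hz : z ∈ stdSimplex ℝ (Fin p))
    {q : Fin p → ℝ} (hq : ∀ k, 0 < q k) : 0 < ∑ k, z k * q k := by
  obtain ⟨k, -, hk⟩ : ∃ k ∈ Finset.univ, 0 < z k := by
    by_contra! h
    have := hz.2 ▸ Finset.sum_nonpos h
    linarith
  exact Finset.sum_pos' (fun j _ => mul_nonneg (hz.1 j) (hq j).le)
    ⟨k, Finset.mem_univ _, mul_pos hk (hq k)⟩

theorem combWeight_nonneg (hQpos : ∀ k x, 0 < Qhat k x) {z : Fin p → ℝ}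
    (hz : z ∈ stdSimplex ℝ (Fin p)) (k : Fin p) (x : X) : 0 ≤ combWeight Qhat z k x :=
  div_nonneg (mul_nonneg (hz.1 k) (hQpos k x).le)
    (sum_mul_pos_of_mem_stdSimplex hz fun j => hQpos j x).le

theorem sum_combWeight (hQpos : ∀ k x, 0 < Qhat k x) {z : Fin p → ℝ}
    (hz : z ∈ stdSimplex ℝ (Fin p)) (x : X) : ∑ k, combWeight Qhat z k x = 1 := by
  simp only [combWeight]
  rw [← Finset.sum_div, div_self (sum_mul_pos_of_mem_stdSimplex hz fun j => hQpos j x).ne']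

theorem measurable_combWeight [MeasurableSpace X] (hQmeas : ∀ k, Measurable (Qhat k))
    (z : Fin p → ℝ) (k : Fin p) : Measurable (combWeight Qhat z k) :=
  ((hQmeas k).const_mul _).div (Finset.measurable_fun_sum _ fun j _ => (hQmeas j).const_mul _)

theorem continuousOn_combWeight (hQpos : ∀ k x, 0 < Qhat k x) (k : Fin p) (x : X) :
    ContinuousOn (fun z => combWeight Qhat z k x) (stdSimplex ℝ (Fin p)) := by
  refine ContinuousOn.div (by fun_prop) (by fun_prop) fun z hz => ?_
  exact (sum_mul_pos_of_mem_stdSimplex hz fun j => hQpos j x).ne'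

end Combination

/-! ### Change of measure -/

variable {X Y Ω : Type*} [MeasurableSpace X] [MeasurableSpace Y] [MeasurableSpace Ω]

theorem toReal_one_div_exponent {α : ℝ≥0∞} (hα : 1 < α) :
    (1 / α).toReal = 1 / α.toReal ∧ (1 - 1 / α).toReal = 1 - 1 / α.toReal := by
  have h1 : (1 / α).toReal = 1 / α.toReal := by simp
  refine ⟨h1, ?_⟩
  rw [ENNReal.toReal_sub_of_le _ ENNReal.one_ne_top, h1, ENNReal.toReal_one]
  rw [one_div]
  exact ENNReal.inv_le_one.2 hα.le

theorem one_sub_one_div_toReal_pos {α : ℝ≥0∞} (hα : 1 < α) : 0 < (1 - 1 / α).toReal := by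
  rw [(toReal_one_div_exponent hα).2]
  rcases eq_or_ne α ∞ with rfl | htop
  · simp
  · have : 1 < α.toReal := by
      rw [← ENNReal.toReal_one]; exact (ENNReal.toReal_lt_toReal ENNReal.one_ne_top htop).2 hα
    rw [sub_pos, div_lt_one (by linarith)]
    exact this

/-- Change of measure for functions bounded by `M`, by Hölder's inequality with the exponents `α` and
`α / (α - 1)`. -/
theorem lintegral_le_expRenyi {P Q : Measure Ω} [IsFiniteMeasure P] [IsFiniteMeasure Q]
    {α : ℝ≥0∞} (hα : 1 < α) {g : Ω → ℝ≥0∞} (hg : Measurable g) {M : ℝ≥0} (hM : ∀ ω, g ω ≤ M)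
    {c : ℝ≥0∞} (hc : c ≠ 0) (hgc : ∫⁻ ω, g ω ∂Q ≤ c) :
    ∫⁻ ω, g ω ∂P ≤ (c * expRenyi α P Q) ^ (1 - 1 / α).toReal * (M : ℝ≥0∞) ^ (1 / α).toReal := by
  have he := one_sub_one_div_toReal_pos hα
  rcases eq_or_ne M 0 with rfl | hM0
  · have : ∀ ω, g ω = 0 := fun ω => le_antisymm (by simpa using hM ω) zero_le
    simp [this]
  by_cases hPQ : P ≪ Q
  swap
  · have h1 : (M : ℝ≥0∞) ^ (1 / α).toReal ≠ 0 := by simp [hM0]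
    rw [expRenyi, if_neg hPQ, ENNReal.mul_top hc, ENNReal.top_rpow_of_pos he, ENNReal.top_mul h1]
    exact le_top
  rw [← lintegral_rnDeriv_mul hPQ hg.aemeasurable, expRenyi, if_pos hPQ]
  rcases eq_or_ne α ∞ with rfl | htop
  · simp only [if_true, ENNReal.div_top, tsub_zero, ENNReal.toReal_one, ENNReal.rpow_one,
      ENNReal.toReal_zero, ENNReal.rpow_zero, mul_one]
    calc ∫⁻ x, P.rnDeriv Q x * g x ∂Q ≤ ∫⁻ x, essSup (P.rnDeriv Q) Q * g x ∂Q := by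
          refine lintegral_mono_ae ?_
          filter_upwards [ENNReal.ae_le_essSup (P.rnDeriv Q)] with x hx
          gcongr
      _ = essSup (P.rnDeriv Q) Q * ∫⁻ x, g x ∂Q := lintegral_const_mul _ hg
      _ ≤ c * essSup (P.rnDeriv Q) Q := by rw [mul_comm]; gcongr
  · rw [if_neg htop, (toReal_one_div_exponent hα).1, (toReal_one_div_exponent hα).2]
    have ha : 1 < α.toReal := by
      rw [← ENNReal.toReal_one]; exact (ENNReal.toReal_lt_toReal ENNReal.one_ne_top htop).2 hα
    generalize α.toReal = a at ha
    have hconj : a.HolderConjugate a.conjExponent := Real.HolderConjugate.conjExponent ha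
    have hb : a.conjExponent = a / (a - 1) := rfl
    have ha0 : (a : ℝ) ≠ 0 := by linarith
    have ha1 : a - 1 ≠ 0 := by linarith
    have hb1 : a.conjExponent - 1 = 1 / (a - 1) := by rw [hb]; field_simp; ring
    have hbi : 1 / a.conjExponent = 1 - 1 / a := by rw [hb]; field_simp
    have hpow : ∫⁻ x, g x ^ a.conjExponent ∂Q ≤ c * (M : ℝ≥0∞) ^ (1 / (a - 1)) := by
      calc ∫⁻ x, g x ^ a.conjExponent ∂Q ≤ ∫⁻ x, g x * (M : ℝ≥0∞) ^ (1 / (a - 1)) ∂Q := by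
            refine lintegral_mono fun x => ?_
            have h1 : a.conjExponent = 1 + 1 / (a - 1) := by linarith
            have h2 : (0 : ℝ) ≤ 1 / (a - 1) := by
              have : 0 < a - 1 := by linarith
              positivity
            rw [h1, ENNReal.rpow_add_of_nonneg _ _ zero_le_one h2, ENNReal.rpow_one]
            gcongr
            exact hM x
        _ = (∫⁻ x, g x ∂Q) * (M : ℝ≥0∞) ^ (1 / (a - 1)) := lintegral_mul_const _ hg
        _ ≤ _ := by gcongr
    refine (ENNReal.lintegral_mul_le_Lp_mul_Lq Q hconj
      (Measure.measurable_rnDeriv P Q).aemeasurable hg.aemeasurable).trans ?_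
    rw [hbi]
    have he0 : (0 : ℝ) ≤ 1 - 1 / a := by
      rw [sub_nonneg, div_le_one (by linarith)]; exact ha.le
    have e1 : 1 / (a - 1) * (1 - 1 / a) = 1 / a := by field_simp
    calc _ ≤ (∫⁻ x, P.rnDeriv Q x ^ a ∂Q) ^ (1 / a) *
          (c * (M : ℝ≥0∞) ^ (1 / (a - 1))) ^ (1 - 1 / a) := by gcongr
      _ = _ := by
        rw [ENNReal.mul_rpow_of_nonneg _ _ he0, ENNReal.mul_rpow_of_nonneg _ _ he0,
          ← ENNReal.rpow_mul, ← ENNReal.rpow_mul, e1]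
        ring

theorem one_le_expRenyi {P Q : Measure Ω} [IsProbabilityMeasure P] [IsProbabilityMeasure Q]
    {α : ℝ≥0∞} (hα : 1 < α) : 1 ≤ expRenyi α P Q := by
  have h := lintegral_le_expRenyi (P := P) (Q := Q) hα (g := fun _ => 1) measurable_const
    (M := 1) (by simp) one_ne_zero (by simp)
  by_contra! hlt
  simp only [lintegral_const, measure_univ, one_mul, ENNReal.coe_one, ENNReal.one_rpow,
    mul_one] at h
  exact absurd (ENNReal.rpow_lt_one hlt (one_sub_one_div_toReal_pos hα)) (not_lt.2 h)

theorem isProbabilityMeasure_mixture {p : ℕ} {D : Fin p → Measure Ω}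
    (hD : ∀ k, IsProbabilityMeasure (D k)) {w : Fin p → ℝ} (hw : w ∈ stdSimplex ℝ (Fin p)) :
    IsProbabilityMeasure (mixture D w) := by
  refine ⟨?_⟩
  simp only [mixture, Measure.coe_finsetSum, Finset.sum_apply, Measure.smul_apply, measure_univ,
    smul_eq_mul, mul_one]
  rw [← ENNReal.ofReal_sum_of_nonneg fun k _ => hw.1 k, hw.2, ENNReal.ofReal_one]

theorem lintegral_mixture_le {p : ℕ} {D : Fin p → Measure Ω} {w : Fin p → ℝ}
    (hw : w ∈ stdSimplex ℝ (Fin p)) {g : Ω → ℝ≥0∞} {c : ℝ≥0∞}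
    (h : ∀ k, ∫⁻ ω, g ω ∂(D k) ≤ c) : ∫⁻ ω, g ω ∂(mixture D w) ≤ c := by
  rw [mixture, lintegral_finsetSum_measure]
  simp only [lintegral_smul_measure, smul_eq_mul]
  calc ∑ k, ENNReal.ofReal (w k) * ∫⁻ ω, g ω ∂(D k) ≤ ∑ k, ENNReal.ofReal (w k) * c :=
        Finset.sum_le_sum fun k _ => by gcongr; exact h k
    _ = c := by
        rw [← Finset.sum_mul, ← ENNReal.ofReal_sum_of_nonneg fun k _ => hw.1 k, hw.2,
          ENNReal.ofReal_one, one_mul]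

/-- Change of measure from a whole family of mixtures, with the infimum of the divergences. -/
theorem lintegral_le_expRenyiFamily {p : ℕ} {D : Fin p → Measure Ω}
    (hD : ∀ k, IsProbabilityMeasure (D k)) {T : Measure Ω} [IsProbabilityMeasure T]
    {α : ℝ≥0∞} (hα : 1 < α) {g : Ω → ℝ≥0∞} (hg : Measurable g) {M : ℝ≥0} (hM : ∀ ω, g ω ≤ M)
    {c : ℝ≥0∞} (hc : M ≠ 0 → c ≠ 0) (hgc : ∀ k, ∫⁻ ω, g ω ∂(D k) ≤ c) :
    ∫⁻ ω, g ω ∂T ≤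
      (c * expRenyiFamily α T D) ^ (1 - 1 / α).toReal * (M : ℝ≥0∞) ^ (1 / α).toReal := by
  rcases eq_or_ne M 0 with rfl | hM0
  · have : ∀ ω, g ω = 0 := fun ω => le_antisymm (by simpa using hM ω) zero_le
    simp [this]
  have he := one_sub_one_div_toReal_pos hα
  have hm0 : (M : ℝ≥0∞) ^ (1 / α).toReal ≠ 0 := by simp [hM0]
  have hmt : (M : ℝ≥0∞) ^ (1 / α).toReal ≠ ∞ := by simp [hM0]
  rw [← ENNReal.div_le_iff hm0 hmt, ← ENNReal.rpow_inv_le_iff he]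
  have hw : ∀ w ∈ stdSimplex ℝ (Fin p), ((∫⁻ ω, g ω ∂T) / (M : ℝ≥0∞) ^ (1 / α).toReal) ^
      ((1 - 1 / α).toReal)⁻¹ ≤ c * expRenyi α T (mixture D w) := by
    intro w hw
    have := isProbabilityMeasure_mixture hD hw
    rw [ENNReal.rpow_inv_le_iff he, ENNReal.div_le_iff hm0 hmt]
    exact lintegral_le_expRenyi hα hg hM (hc hM0) (lintegral_mixture_le hw hgc)
  rcases eq_or_ne c ∞ with rfl | hct
  · rw [ENNReal.top_mul]
    · exact le_top
    · refine (zero_lt_one.trans_le (le_iInf₂ fun w hw => ?_)).ne'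
      have := isProbabilityMeasure_mixture hD hw
      exact one_le_expRenyi hα
  · rw [mul_comm, ← ENNReal.div_le_iff (hc hM0) hct]
    refine le_iInf₂ fun w hw' => ?_
    rw [ENNReal.div_le_iff (hc hM0) hct, mul_comm]
    exact hw w hw'

/-! ### The estimated distributions -/

section Estimates

variable {p : ℕ} {D : Fin p → Measure (X × Y)} {κ : Kernel X Y} {Qhat : Fin p → X → ℝ}

theorem isProbabilityMeasure_avgMarginal (hp : 0 < p) (hD : ∀ k, IsProbabilityMeasure (D k)) :
    IsProbabilityMeasure (avgMarginal D) := by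
  refine ⟨?_⟩
  have : (p : ℝ≥0∞) ≠ 0 := by exact_mod_cast hp.ne'
  simp only [avgMarginal, Measure.smul_apply, Measure.coe_finsetSum, Finset.sum_apply,
    measure_univ, smul_eq_mul, Finset.sum_const, Finset.card_univ, Fintype.card_fin,
    nsmul_eq_mul, mul_one]
  exact ENNReal.inv_mul_cancel this (ENNReal.natCast_ne_top p)

theorem domainWeight_ne_zero [IsProbabilityMeasure (avgMarginal D)]
    (hQmeas : ∀ k, Measurable (Qhat k)) (hQpos : ∀ k x, 0 < Qhat k x) (k : Fin p) :
    domainWeight D Qhat k ≠ 0 := by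
  rw [domainWeight, ← pos_iff_ne_zero, lintegral_pos_iff_support (hQmeas k).ennreal_ofReal]
  have : (Function.support fun x => ENNReal.ofReal (Qhat k x)) = Set.univ := by
    ext x; simp [hQpos k x]
  rw [this, measure_univ]
  exact zero_lt_one

theorem domainWeight_ne_top [IsProbabilityMeasure (avgMarginal D)]
    (hQle : ∀ k x, Qhat k x ≤ 1) (k : Fin p) : domainWeight D Qhat k ≠ ∞ := by
  refine ne_top_of_le_ne_top ENNReal.one_ne_top ?_
  calc domainWeight D Qhat k ≤ ∫⁻ _x, 1 ∂(avgMarginal D) :=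
        lintegral_mono fun x => ENNReal.ofReal_le_one.2 (hQle k x)
    _ = 1 := by simp

/-- Integration against `estJoint`, written with one reference measure for all domains. -/
theorem domainWeight_mul_lintegral_estJoint [IsProbabilityMeasure (avgMarginal D)]
    [IsMarkovKernel κ] (hQmeas : ∀ k, Measurable (Qhat k)) (hQpos : ∀ k x, 0 < Qhat k x)
    (hQle : ∀ k x, Qhat k x ≤ 1) (k : Fin p) {g : X × Y → ℝ≥0∞} (hg : Measurable g) :
    domainWeight D Qhat k * ∫⁻ q, g q ∂(estJoint D κ Qhat k) =
      ∫⁻ q, ENNReal.ofReal (Qhat k q.1) * g q ∂(avgMarginal D ⊗ₘ κ) := by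
  have h0 := domainWeight_ne_zero (D := D) hQmeas hQpos k
  have ht := domainWeight_ne_top (D := D) hQle k
  have hinner : Measurable fun x => ∫⁻ y, g (x, y) ∂(κ x) := hg.lintegral_kernel_prod_right'
  have hdens : Measurable fun x => ENNReal.ofReal (Qhat k x) / domainWeight D Qhat k :=
    (hQmeas k).ennreal_ofReal.div_const _
  have hq : Measurable fun q : X × Y => ENNReal.ofReal (Qhat k q.1) :=
    ((hQmeas k).comp measurable_fst).ennreal_ofReal
  have hqg : Measurable fun q : X × Y => ENNReal.ofReal (Qhat k q.1) * g q := hq.mul hg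
  have hsf : SFinite (estMarginal D Qhat k) := by unfold estMarginal; infer_instance
  rw [estJoint, Measure.lintegral_compProd hg, Measure.lintegral_compProd hqg, estMarginal,
    lintegral_withDensity_eq_lintegral_mul _ hdens hinner,
    ← lintegral_const_mul _ (hdens.mul hinner)]
  refine lintegral_congr fun x => ?_
  rw [Pi.mul_apply, ← mul_assoc, ENNReal.mul_div_cancel h0 ht,
    ← lintegral_const_mul' _ _ ENNReal.ofReal_ne_top]

theorem isProbabilityMeasure_estJoint [IsProbabilityMeasure (avgMarginal D)]
    [IsMarkovKernel κ] (hQmeas : ∀ k, Measurable (Qhat k)) (hQpos : ∀ k x, 0 < Qhat k x)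
    (hQle : ∀ k x, Qhat k x ≤ 1) (k : Fin p) :
    IsProbabilityMeasure (estJoint D κ Qhat k) := by
  have h0 := domainWeight_ne_zero (D := D) hQmeas hQpos k
  have ht := domainWeight_ne_top (D := D) hQle k
  have h := domainWeight_mul_lintegral_estJoint (D := D) (κ := κ) hQmeas hQpos hQle k
    (g := fun _ => 1) measurable_const
  have hq : Measurable fun q : X × Y => ENNReal.ofReal (Qhat k q.1) :=
    ((hQmeas k).comp measurable_fst).ennreal_ofReal
  simp only [mul_one] at h
  rw [Measure.lintegral_compProd hq] at h
  simp only [lintegral_const, measure_univ, mul_one, one_mul] at h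
  change _ = domainWeight D Qhat k at h
  refine ⟨?_⟩
  have h2 : domainWeight D Qhat k * estJoint D κ Qhat k Set.univ = domainWeight D Qhat k * 1 := by
    rw [mul_one]; exact h
  exact (ENNReal.mul_right_inj h0 ht).1 h2

/-- Let `U k` be the loss of the `k`-th predictor and `φ z` the loss of the combination with
parameter `z`, which convexity bounds by the combination of the `U k`. For some `z` the expected loss
of the combination is, on every estimated distribution, at most the largest expected loss of
a predictor on its own estimated distribution. -/
theorem exists_forall_lintegral_estJoint_le (hp : 0 < p) [IsProbabilityMeasure (avgMarginal D)]
    [IsMarkovKernel κ] (hQmeas : ∀ k, Measurable (Qhat k)) (hQpos : ∀ k x, 0 < Qhat k x)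
    (hQle : ∀ k x, Qhat k x ≤ 1) {M : ℝ≥0} {U : Fin p → X × Y → ℝ≥0∞}
    (hU : ∀ k, Measurable (U k)) (hUM : ∀ k q, U k q ≤ M) {φ : (Fin p → ℝ) → X × Y → ℝ≥0∞}
    (hφ : ∀ z ∈ stdSimplex ℝ (Fin p), Measurable (φ z))
    (hφM : ∀ z ∈ stdSimplex ℝ (Fin p), ∀ q, φ z q ≤ M)
    (hφcont : ∀ q, ContinuousOn (fun z => φ z q) (stdSimplex ℝ (Fin p)))
    (hφU : ∀ z ∈ stdSimplex ℝ (Fin p), ∀ q,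
      φ z q ≤ ∑ k, ENNReal.ofReal (combWeight Qhat z k q.1) * U k q) :
    ∃ z ∈ stdSimplex ℝ (Fin p), ∀ k, ∫⁻ q, φ z q ∂(estJoint D κ Qhat k) ≤
      ⨆ j, ∫⁻ q, U j q ∂(estJoint D κ Qhat j) := by
  have : Nonempty (Fin p) := ⟨⟨0, hp⟩⟩
  have hprob := isProbabilityMeasure_estJoint (D := D) (κ := κ) hQmeas hQpos hQle
  have hint : ∀ g : X × Y → ℝ≥0∞, (∀ q, g q ≤ M) → ∀ k,
      ∫⁻ q, g q ∂(estJoint D κ Qhat k) ≤ M := by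
    intro g hg k
    calc ∫⁻ q, g q ∂(estJoint D κ Qhat k) ≤ ∫⁻ _q, M ∂(estJoint D κ Qhat k) := lintegral_mono hg
      _ = M := by simp
  have hne : ∀ g : X × Y → ℝ≥0∞, (∀ q, g q ≤ M) → ∀ k,
      ∫⁻ q, g q ∂(estJoint D κ Qhat k) ≠ ∞ := fun g hg k =>
    ne_top_of_le_ne_top ENNReal.coe_ne_top (hint g hg k)
  set E : ℝ≥0∞ := ⨆ j, ∫⁻ q, U j q ∂(estJoint D κ Qhat j)
  have hE : E ≠ ∞ := ne_top_of_le_ne_top ENNReal.coe_ne_top (iSup_le fun k => hint _ (hUM k) k)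
  have hq0 := domainWeight_ne_zero (D := D) hQmeas hQpos
  have hqt := domainWeight_ne_top (D := D) hQle
  obtain ⟨z, hz, hzG⟩ := exists_mem_stdSimplex_forall_nonpos
    (G := fun k z => (∫⁻ q, φ z q ∂(estJoint D κ Qhat k)).toReal - E.toReal)
    (q := fun k => (domainWeight D Qhat k).toReal) (by
      intro k
      refine ContinuousOn.sub ?_ continuousOn_const
      intro z hz
      refine (ENNReal.tendsto_toReal (hne _ (hφM z hz) k)).comp ?_
      refine tendsto_lintegral_filter_of_dominated_convergence (fun _ => (M : ℝ≥0∞)) ?_ ?_ ?_ ?_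
      · filter_upwards [self_mem_nhdsWithin] with w hw using hφ w hw
      · filter_upwards [self_mem_nhdsWithin] with w hw using Filter.Eventually.of_forall (hφM w hw)
      · simp
      · exact Filter.Eventually.of_forall fun q => hφcont q z hz)
    (fun k => ENNReal.toReal_pos (hq0 k) (hqt k)) (by
      intro z hz
      have hmz := hφ z hz
      have hmain : ∑ k, ENNReal.ofReal (z k) * (domainWeight D Qhat k *
          ∫⁻ q, φ z q ∂(estJoint D κ Qhat k)) ≤
          ∑ k, ENNReal.ofReal (z k) * (domainWeight D Qhat k * E) := by
        have hQ : ∀ k, Measurable fun q : X × Y => ENNReal.ofReal (Qhat k q.1) := fun k =>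
          ((hQmeas k).comp measurable_fst).ennreal_ofReal
        have hpull : ∀ g : Fin p → X × Y → ℝ≥0∞, (∀ k, Measurable (g k)) →
            ∑ k, ENNReal.ofReal (z k) * (domainWeight D Qhat k *
              ∫⁻ q, g k q ∂(estJoint D κ Qhat k)) =
            ∫⁻ q, ∑ k, ENNReal.ofReal (z k * Qhat k q.1) * g k q ∂(avgMarginal D ⊗ₘ κ) := by
          intro g hg
          rw [lintegral_finsetSum]
          · refine Finset.sum_congr rfl fun k _ => ?_
            rw [domainWeight_mul_lintegral_estJoint hQmeas hQpos hQle k (hg k),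
              ← lintegral_const_mul' _ _ ENNReal.ofReal_ne_top]
            simp only [ENNReal.ofReal_mul (hz.1 k), mul_assoc]
          · exact fun k _ => (((hQmeas k).comp measurable_fst).const_mul _).ennreal_ofReal.mul (hg k)
        calc _ = ∫⁻ q, ∑ k, ENNReal.ofReal (z k * Qhat k q.1) * φ z q ∂(avgMarginal D ⊗ₘ κ) :=
              hpull (fun _ => φ z) fun _ => hmz
          _ ≤ ∫⁻ q, ∑ k, ENNReal.ofReal (z k * Qhat k q.1) * U k q ∂(avgMarginal D ⊗ₘ κ) := by
              refine lintegral_mono fun q => ?_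
              have hS := sum_mul_pos_of_mem_stdSimplex hz fun j => hQpos j q.1
              rw [← Finset.sum_mul, ← ENNReal.ofReal_sum_of_nonneg fun k _ =>
                mul_nonneg (hz.1 k) (hQpos k q.1).le]
              refine (mul_le_mul_right (hφU z hz q) _).trans_eq ?_
              rw [Finset.mul_sum]
              refine Finset.sum_congr rfl fun k _ => ?_
              rw [← mul_assoc, ← ENNReal.ofReal_mul hS.le, combWeight, mul_div_cancel₀ _ hS.ne']
          _ = ∑ k, ENNReal.ofReal (z k) * (domainWeight D Qhat k *
              ∫⁻ q, U k q ∂(estJoint D κ Qhat k)) := (hpull U hU).symm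
          _ ≤ _ := by
              gcongr with k
              exact le_iSup (fun j => ∫⁻ q, U j q ∂(estJoint D κ Qhat j)) k
      have hreal := ENNReal.toReal_mono (by
        refine ENNReal.sum_ne_top.2 fun k _ => ?_
        exact ENNReal.mul_ne_top ENNReal.ofReal_ne_top (ENNReal.mul_ne_top (hqt k) hE)) hmain
      rw [ENNReal.toReal_sum fun k _ => ENNReal.mul_ne_top ENNReal.ofReal_ne_top
          (ENNReal.mul_ne_top (hqt k) (hne _ (hφM z hz) k)),
        ENNReal.toReal_sum fun k _ => ENNReal.mul_ne_top ENNReal.ofReal_ne_top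
          (ENNReal.mul_ne_top (hqt k) hE)] at hreal
      simp only [ENNReal.toReal_mul, ENNReal.toReal_ofReal (hz.1 _)] at hreal
      rw [← sub_nonpos, ← Finset.sum_sub_distrib] at hreal
      refine le_trans (Finset.sum_le_sum fun k _ => le_of_eq ?_) hreal
      ring)
  refine ⟨z, hz, fun k => ?_⟩
  rw [← ENNReal.toReal_le_toReal (hne _ (hφM z hz) k) hE]
  exact sub_nonpos.1 (hzG k)

end Estimates

/-! ### The guarantee for an abstract loss -/

section Guarantee

variable {X Y : Type*} [MeasurableSpace X] [MeasurableSpace Y] {p : ℕ} {D : Fin p → Measure (X × Y)}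
  {κ : Kernel X Y} {Qhat : Fin p → X → ℝ}

theorem one_lt_two_mul_and_sub_one {α : ℝ≥0∞} (hα : 1 < α) : 1 < 2 * α ∧ 1 < 2 * α - 1 := by
  rw [two_mul]
  exact ⟨hα.trans_le le_self_add, lt_tsub_iff_right.2 (ENNReal.add_lt_add hα hα)⟩

/-- The exponents of two changes of measure of orders `2α - 1` and `2α` combine to those of one change
of order `α`. -/
theorem rpow_mul_rpow_two_step {α : ℝ≥0∞} (hα : 1 < α) (a b : ℝ≥0∞) (m : ℝ≥0∞) :
    (a ^ (1 - 1 / (2 * α - 1)).toReal * m ^ (1 / (2 * α - 1)).toReal * b)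
        ^ (1 - 1 / (2 * α)).toReal * m ^ (1 / (2 * α)).toReal =
      a ^ (1 - 1 / α).toReal * b ^ (1 - 1 / (2 * α)).toReal * m ^ (1 / α).toReal := by
  rcases eq_or_ne α ∞ with rfl | htop
  · simp
  have ha : 1 < α.toReal := by
    rw [← ENNReal.toReal_one]; exact (ENNReal.toReal_lt_toReal ENNReal.one_ne_top htop).2 hα
  obtain ⟨h2, h1⟩ := one_lt_two_mul_and_sub_one hα
  have e2 : (2 * α).toReal = 2 * α.toReal := by simp
  have e1 : (2 * α - 1).toReal = 2 * α.toReal - 1 := by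
    rw [ENNReal.toReal_sub_of_le h2.le (ENNReal.mul_ne_top (by simp) htop), e2, ENNReal.toReal_one]
  rw [(toReal_one_div_exponent hα).1, (toReal_one_div_exponent hα).2,
    (toReal_one_div_exponent h1).1, (toReal_one_div_exponent h1).2,
    (toReal_one_div_exponent h2).1, (toReal_one_div_exponent h2).2, e1, e2]
  generalize α.toReal = t at ha
  have ht : t ≠ 0 := by linarith
  have ht1 : 2 * t - 1 ≠ 0 := by linarith
  have p2 : 0 ≤ 1 - 1 / (2 * t) := by
    rw [sub_nonneg, div_le_one (by linarith)]; linarith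
  have p1 : 0 ≤ 1 / (2 * t - 1) * (1 - 1 / (2 * t)) := by
    have : 0 < 2 * t - 1 := by linarith
    positivity
  have p3 : 0 ≤ 1 / (2 * t) := by
    have : 0 < t := by linarith
    positivity
  rw [ENNReal.mul_rpow_of_nonneg _ _ p2, ENNReal.mul_rpow_of_nonneg _ _ p2, ← ENNReal.rpow_mul,
    ← ENNReal.rpow_mul]
  have q1 : (1 - 1 / (2 * t - 1)) * (1 - 1 / (2 * t)) = 1 - 1 / t := by field_simp; ring
  have q2 : 1 / t = 1 / (2 * t - 1) * (1 - 1 / (2 * t)) + 1 / (2 * t) := by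
    have : 1 - 1 / (2 * t) = (2 * t - 1) / (2 * t) := by field_simp
    rw [this, one_div_mul_eq_div, div_right_comm, div_self ht1]
    field_simp
    norm_num
  rw [q1, q2, ENNReal.rpow_add_of_nonneg _ _ p1 p3]
  ring

/-- A parameter whose combination has loss at most `ε̂` on all estimated distributions satisfies the
bound on all targets: one changes measure from `D̂_k` to `D_k`, passes to mixtures by linearity, and
changes measure to the target. -/
theorem lintegral_le_guaranteeBound (hD : ∀ k, IsProbabilityMeasure (D k))
    (hprob : ∀ k, IsProbabilityMeasure (estJoint D κ Qhat k)) (hp : 0 < p)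
    {ε δ M : ℝ≥0} (hδ : 0 < δ) {g : X × Y → ℝ≥0∞} (hg : Measurable g) (hM : ∀ q, g q ≤ M)
    {α : ℝ≥0∞} (hα : 1 < α)
    (h : ∀ k, ∫⁻ q, g q ∂(estJoint D κ Qhat k) ≤ epsHat α ε M D κ Qhat)
    (T : Measure (X × Y)) [IsProbabilityMeasure T] :
    ∫⁻ q, g q ∂T ≤ guaranteeBound α ε δ M D κ Qhat T := by
  obtain ⟨h2, h1⟩ := one_lt_two_mul_and_sub_one hα
  have hc : epsHat α ε M D κ Qhat + δ ≠ 0 := by simp [hδ.ne']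
  have hd : dHat' α D κ Qhat ≠ 0 := by
    refine (zero_lt_one.trans_le ((one_le_expRenyi (P := D ⟨0, hp⟩)
      (Q := estJoint D κ Qhat ⟨0, hp⟩) h1).trans ?_)).ne'
    exact le_iSup (fun k => expRenyi (2 * α - 1) (D k) (estJoint D κ Qhat k)) ⟨0, hp⟩
  have hDk : ∀ k, ∫⁻ q, g q ∂(D k) ≤
      ((epsHat α ε M D κ Qhat + δ) * dHat' α D κ Qhat) ^ (1 - 1 / (2 * α - 1)).toReal *
        (M : ℝ≥0∞) ^ (1 / (2 * α - 1)).toReal := by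
    intro k
    refine (lintegral_le_expRenyi h1 hg hM hc ((h k).trans le_self_add)).trans ?_
    gcongr
    exact le_iSup (fun k => expRenyi (2 * α - 1) (D k) (estJoint D κ Qhat k)) k
  refine (lintegral_le_expRenyiFamily hD h2 hg hM (fun hM0 => ?_) hDk).trans_eq ?_
  · refine mul_ne_zero ?_ (by simp [hM0])
    intro h0
    rcases ENNReal.rpow_eq_zero_iff.1 h0 with h | h
    · exact mul_ne_zero hc hd h.1
    · exact absurd h.2 (not_lt.2 ENNReal.toReal_nonneg)
  · exact rpow_mul_rpow_two_step hα _ _ _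

/-- The guarantee for losses `U k` of the predictors and `φ z` of the combinations that are only known
to satisfy the inequality that convexity provides. -/
theorem exists_forall_lintegral_le_guaranteeBound (hp : 0 < p)
    (hD : ∀ k, IsProbabilityMeasure (D k)) [IsMarkovKernel κ]
    (hQmeas : ∀ k, Measurable (Qhat k)) (hQpos : ∀ k x, 0 < Qhat k x)
    (hQle : ∀ k x, Qhat k x ≤ 1) {ε M : ℝ≥0} (hε : 0 < ε) {U : Fin p → X × Y → ℝ≥0∞}
    (hU : ∀ k, Measurable (U k)) (hUM : ∀ k q, U k q ≤ M) (hUε : ∀ k, ∫⁻ q, U k q ∂(D k) ≤ ε)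
    {φ : (Fin p → ℝ) → X × Y → ℝ≥0∞}
    (hφ : ∀ z ∈ stdSimplex ℝ (Fin p), Measurable (φ z))
    (hφcont : ∀ q, ContinuousOn (fun z => φ z q) (stdSimplex ℝ (Fin p)))
    (hφU : ∀ z ∈ stdSimplex ℝ (Fin p), ∀ q,
      φ z q ≤ ∑ k, ENNReal.ofReal (combWeight Qhat z k q.1) * U k q) {δ : ℝ≥0} (hδ : 0 < δ) :
    ∃ z ∈ stdSimplex ℝ (Fin p), ∀ α : ℝ≥0∞, 1 < α → ∀ T : Measure (X × Y),
      IsProbabilityMeasure T → ∫⁻ q, φ z q ∂T ≤ guaranteeBound α ε δ M D κ Qhat T := by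
  have := isProbabilityMeasure_avgMarginal hp hD
  have hprob := isProbabilityMeasure_estJoint (D := D) (κ := κ) hQmeas hQpos hQle
  have hφM : ∀ z ∈ stdSimplex ℝ (Fin p), ∀ q, φ z q ≤ M := by
    intro z hz q
    calc φ z q ≤ ∑ k, ENNReal.ofReal (combWeight Qhat z k q.1) * U k q := hφU z hz q
      _ ≤ ∑ k, ENNReal.ofReal (combWeight Qhat z k q.1) * M :=
          Finset.sum_le_sum fun k _ => by gcongr; exact hUM k q
      _ = M := by
          rw [← Finset.sum_mul, ← ENNReal.ofReal_sum_of_nonneg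
            fun k _ => combWeight_nonneg hQpos hz k q.1, sum_combWeight hQpos hz, ENNReal.ofReal_one,
            one_mul]
  obtain ⟨z, hz, hzU⟩ := exists_forall_lintegral_estJoint_le (D := D) (κ := κ) hp hQmeas hQpos hQle
    hU hUM hφ hφM hφcont hφU
  refine ⟨z, hz, fun α hα T hT => ?_⟩
  refine lintegral_le_guaranteeBound hD hprob hp hδ (hφ z hz) (hφM z hz) hα (fun k => ?_) T
  refine (hzU k).trans (iSup_le fun j => ?_)
  refine (lintegral_le_expRenyi hα (hU j) (hUM j) (by simpa using hε.ne') (hUε j)).trans ?_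
  rw [epsHat]
  gcongr
  exact le_iSup (fun k => expRenyi α (estJoint D κ Qhat k) (D k)) j

end Guarantee

/-! ### Jensen's inequality for the two loss models -/

/-- Jensen's inequality for an extended nonnegative loss, at points where it is bounded. -/
theorem map_sum_le_of_convexOn_ennreal {ι : Type*} [Fintype ι] {s : Set ℝ} {l : ℝ → ℝ≥0∞}
    (hl : ConvexOn ℝ≥0 s l) {w : ι → ℝ} (hw : ∀ i, 0 ≤ w i) (hw1 : ∑ i, w i = 1) {t : ι → ℝ}
    (ht : ∀ i, t i ∈ s) {M : ℝ≥0} (hM : ∀ i, l (t i) ≤ M) :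
    l (∑ i, w i * t i) ≤ ∑ i, ENNReal.ofReal (w i) * l (t i) := by
  -- on the sublevel set at `M` the loss is finite, hence a convex function with real values
  let S : Set ℝ := {x ∈ s | l x ≤ M}
  have hcomb : ∀ x ∈ S, ∀ y ∈ S, ∀ a b : ℝ, 0 ≤ a → 0 ≤ b → a + b = 1 → a • x + b • y ∈ S ∧
      l (a • x + b • y) ≤ ENNReal.ofReal a * l x + ENNReal.ofReal b * l y := by
    intro x hx y hy a b ha hb hab
    lift a to ℝ≥0 using ha
    lift b to ℝ≥0 using hb
    have hab' : a + b = 1 := by exact_mod_cast hab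
    have h1 := hl.1 hx.1 hy.1 (zero_le (a := a)) (zero_le (a := b)) hab'
    have h2 := hl.2 hx.1 hy.1 (zero_le (a := a)) (zero_le (a := b)) hab'
    simp only [ENNReal.ofReal_coe_nnreal]
    refine ⟨⟨h1, h2.trans ?_⟩, h2⟩
    calc (a : ℝ≥0∞) * l x + b * l y ≤ a * M + b * M := by
          gcongr
          · exact hx.2
          · exact hy.2
      _ = M := by rw [← add_mul, ← ENNReal.coe_add, hab', ENNReal.coe_one, one_mul]
  have hfin : ∀ x ∈ S, l x ≠ ∞ := fun x hx => ne_top_of_le_ne_top ENNReal.coe_ne_top hx.2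
  have hconv : ConvexOn ℝ S fun x => (l x).toReal := by
    refine ⟨fun x hx y hy a b ha hb hab => (hcomb x hx y hy a b ha hb hab).1,
      fun x hx y hy a b ha hb hab => ?_⟩
    have hx' := ENNReal.mul_ne_top (ENNReal.ofReal_ne_top (r := a)) (hfin x hx)
    have hy' := ENNReal.mul_ne_top (ENNReal.ofReal_ne_top (r := b)) (hfin y hy)
    have h := ENNReal.toReal_mono (ENNReal.add_ne_top.2 ⟨hx', hy'⟩)
      (hcomb x hx y hy a b ha hb hab).2
    simpa [ENNReal.toReal_add hx' hy', ENNReal.toReal_mul, ENNReal.toReal_ofReal ha,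
      ENNReal.toReal_ofReal hb] using h
  have htS : ∀ i ∈ Finset.univ, t i ∈ S := fun i _ => ⟨ht i, hM i⟩
  have hmem := hconv.1.sum_mem (fun i _ => hw i) hw1 htS
  have h := hconv.map_sum_le (fun i _ => hw i) hw1 htS
  simp only [smul_eq_mul] at h hmem
  have hterm : ∀ i ∈ Finset.univ, ENNReal.ofReal (w i) * l (t i) ≠ ∞ := fun i hi =>
    ENNReal.mul_ne_top ENNReal.ofReal_ne_top (hfin _ (htS i hi))
  rw [← ENNReal.toReal_le_toReal (hfin _ hmem) (ENNReal.sum_ne_top.2 hterm),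
    ENNReal.toReal_sum hterm]
  simpa [ENNReal.toReal_mul, ENNReal.toReal_ofReal (hw _)] using h

/-- Convexity of a real-valued nonnegative function, read in `[0, ∞]`. -/
theorem convexOn_coe_ennreal {s : Set ℝ} {l : ℝ → ℝ≥0} (hl : ConvexOn ℝ s fun t => (l t : ℝ)) :
    ConvexOn ℝ≥0 s fun t => (l t : ℝ≥0∞) := by
  refine ⟨fun x hx y hy a b _ _ hab => ?_, fun x hx y hy a b _ _ hab => ?_⟩
  · exact hl.1 hx hy a.2 b.2 (congrArg NNReal.toReal hab)
  · have h := hl.2 hx hy a.2 b.2 (congrArg NNReal.toReal hab)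
    simp only [smul_eq_mul] at h
    have h' : l (a • x + b • y) ≤ a * l x + b * l y := by
      rw [← NNReal.coe_le_coe]
      exact h
    change ((l (a • x + b • y) : ℝ≥0) : ℝ≥0∞) ≤ (a : ℝ≥0∞) * l x + b * l y
    exact_mod_cast h'

end MSA

theorem mainTheorem3 {X Y : Type*} [MeasurableSpace X] [MeasurableSpace Y]
    {p : ℕ} (hp : 0 < p)
    -- the source domains, with their common conditional distribution `κ x = D(· | x)`
    (D : Fin p → Measure (X × Y)) (hD : ∀ k, IsProbabilityMeasure (D k))
    (κ : Kernel X Y) (hκ : IsMarkovKernel κ) (hcond : ∀ k, D k = (D k).fst ⊗ₘ κ)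
    -- the estimates `Q̂(k | x)` of the conditional probabilities of domain membership
    (Qhat : Fin p → X → ℝ) (hQmeas : ∀ k, Measurable (Qhat k))
    (hQpos : ∀ k x, 0 < Qhat k x) (hQle : ∀ k x, Qhat k x ≤ 1)
    (ε M : ℝ≥0) (hε : 0 < ε) :
    -- regression model
    (∀ (l : ℝ → Y → ℝ≥0) (h : Fin p → X → ℝ),
      Measurable (Function.uncurry l) →
      (∀ y, ConvexOn ℝ Set.univ fun t => (l t y : ℝ)) →
      (∀ y, Continuous fun t => l t y) →
      (∀ k, Measurable (h k)) →
      (∀ k x y, l (h k x) y ≤ M) →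
      (∀ k, MSA.lossReg l (D k) (h k) ≤ ε) →
      ∀ δ : ℝ≥0, 0 < δ → ∃ z ∈ stdSimplex ℝ (Fin p),
        ∀ α : ℝ≥0∞, 1 < α → ∀ T : Measure (X × Y), IsProbabilityMeasure T →
          MSA.lossReg l T (MSA.gHatReg Qhat h z) ≤ MSA.guaranteeBound α ε δ M D κ Qhat T) ∧
    -- probability model
    (∀ (l : ℝ → ℝ≥0∞) (h : Fin p → X → Y → ℝ),
      ConvexOn ℝ≥0 (Set.Icc 0 1) l →
      ContinuousOn l (Set.Icc 0 1) →
      (∀ k, Measurable (Function.uncurry (h k))) →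
      (∀ k x y, h k x y ∈ Set.Icc (0 : ℝ) 1) →
      (∀ k x y, l (h k x y) ≤ M) →
      (∀ k, MSA.lossProb l (D k) (h k) ≤ ε) →
      ∀ δ : ℝ≥0, 0 < δ → ∃ z ∈ stdSimplex ℝ (Fin p),
        ∀ α : ℝ≥0∞, 1 < α → ∀ T : Measure (X × Y), IsProbabilityMeasure T →
          MSA.lossProb l T (MSA.gHatProb Qhat h z) ≤
            MSA.guaranteeBound α ε δ M D κ Qhat T) := by
  constructor
  · intro l h hlmeas hlconv hlcont hh hM hloss δ hδ
    have hmeas : ∀ g : X → ℝ, Measurable g →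
        Measurable fun q : X × Y => (l (g q.1) q.2 : ℝ≥0∞) := fun g hg =>
      (hlmeas.comp ((hg.comp measurable_fst).prodMk measurable_snd)).coe_nnreal_ennreal
    refine MSA.exists_forall_lintegral_le_guaranteeBound hp hD hQmeas hQpos hQle hε
      (U := fun k q => (l (h k q.1) q.2 : ℝ≥0∞)) (fun k => hmeas _ (hh k))
      (fun k q => ENNReal.coe_le_coe.2 (hM k q.1 q.2)) hloss
      (φ := fun z q => (l (MSA.gHatReg Qhat h z q.1) q.2 : ℝ≥0∞)) (fun z _ => hmeas _ ?_)
      (fun q => ?_) (fun z hz q => ?_) hδ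
    · exact Finset.measurable_fun_sum _ fun k _ => (MSA.measurable_combWeight hQmeas z k).mul (hh k)
    · refine (ENNReal.continuous_coe.comp (hlcont q.2)).comp_continuousOn ?_
      exact continuousOn_finsetSum _ fun k _ =>
        (MSA.continuousOn_combWeight hQpos k q.1).mul continuousOn_const
    · exact MSA.map_sum_le_of_convexOn_ennreal (MSA.convexOn_coe_ennreal (hlconv q.2))
        (fun k => MSA.combWeight_nonneg hQpos hz k q.1) (MSA.sum_combWeight hQpos hz q.1)
        (fun _ => Set.mem_univ _) fun k => ENNReal.coe_le_coe.2 (hM k q.1 q.2)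
  · intro l h hlconv hlcont hh hI hM hloss δ hδ
    -- the loss is continuous on the unit interval only, where all predictors take their values
    have hmeas : ∀ g : X × Y → ℝ, Measurable g → (∀ q, g q ∈ Set.Icc (0 : ℝ) 1) →
        Measurable fun q => l (g q) := fun g hg hgI =>
      (continuousOn_iff_continuous_domRestrict.1 hlcont).measurable.comp (hg.subtype_mk (h := hgI))
    have hgI : ∀ z ∈ stdSimplex ℝ (Fin p), ∀ q : X × Y,
        MSA.gHatProb Qhat h z q.1 q.2 ∈ Set.Icc (0 : ℝ) 1 := fun z hz q =>
      (convex_Icc (0 : ℝ) 1).sum_mem (fun k _ => MSA.combWeight_nonneg hQpos hz k q.1)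
        (MSA.sum_combWeight hQpos hz q.1) fun k _ => hI k q.1 q.2
    refine MSA.exists_forall_lintegral_le_guaranteeBound hp hD hQmeas hQpos hQle hε
      (U := fun k q => l (h k q.1 q.2)) (fun k => hmeas _ (hh k) fun q => hI k q.1 q.2)
      (fun k q => hM k q.1 q.2) hloss
      (φ := fun z q => l (MSA.gHatProb Qhat h z q.1 q.2)) (fun z hz => hmeas _ ?_ (hgI z hz))
      (fun q => ?_) (fun z hz q => ?_) hδ
    · exact Finset.measurable_fun_sum _ fun k _ =>
        ((MSA.measurable_combWeight hQmeas z k).comp measurable_fst).mul (hh k)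
    · refine hlcont.comp ?_ fun z hz => hgI z hz q
      exact continuousOn_finsetSum _ fun k _ =>
        (MSA.continuousOn_combWeight hQpos k q.1).mul continuousOn_const
    · exact MSA.map_sum_le_of_convexOn_ennreal hlconv
        (fun k => MSA.combWeight_nonneg hQpos hz k q.1) (MSA.sum_combWeight hQpos hz q.1)
        (fun k => hI k q.1 q.2) fun k => hM k q.1 q.2
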